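/- All groups are additively written abelian groups. A subgroup $H$ of a group $A$ is essential in $A$ if $H\cap S\neq\{0\}$ for every non-zero subgroup $S$ of $A$. A group $G$ is called semi-generalized co-Bassian if, for every subgroup $H\le G$ and every injective homomorphism $\varphi:G\to G/H$, the image $\varphi(G)$ is essential in some direct summand of $G/H$. Theorem. Let $G$ be an abelian group of finite torsion-free rank (that is, the cardinalities of the $\mathbb{Z}$-linearly independent subsets of $G$ are bounded by an integer), let $T$ be its torsion subgroup and, for a prime $p$, let $T_p=\{x\in G: p^kx=0 \text{ for some } k\ge 0\}$ be the $p$-component of $T$. Then $G$ is semi-generalized co-Bassian if and only if, for every prime $p$, $T_p$ is semi-generalized co-Bassian and at least one of the following holds: (a) $T_p$ has finite $p$-rank, i.e. $\{x\in T_p: px=0\}$ is finite-dimensional over $\mathbb{Z}/p\mathbb{Z}$; (b) $T_p$ is divisible; or (c) $G/T$ is $p$-divisible, i.e. $p(G/T)=G/T$. -/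

import Mathlib

open scoped Cardinal

/-- `H ≤ A` is essential in `A` (both viewed as subgroups of an ambient group `X`): `H` meets every
non-zero subgroup of `A` in a non-zero subgroup. -/
def IsEssentialIn {X : Type*} [AddCommGroup X] (H A : AddSubgroup X) : Prop :=
  H ≤ A ∧ ∀ S : AddSubgroup X, S ≤ A → S ≠ ⊥ → H ⊓ S ≠ ⊥

/-- `A` is a direct summand of `X`: there is `B ≤ X` with `A + B = X` and `A ∩ B = 0`. -/
def IsDirectSummand {X : Type*} [AddCommGroup X] (A : AddSubgroup X) : Prop :=
  ∃ B : AddSubgroup X, IsCompl A B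

/-- A group `G` is semi-generalized co-Bassian if for every `H ≤ G` and every injective homomorphism
`φ : G → G / H`, the image of `φ` is essential in some direct summand of `G / H`. -/
def IsSemiGeneralizedCoBassian (G : Type*) [AddCommGroup G] : Prop :=
  ∀ (H : AddSubgroup G) (φ : G →+ G ⧸ H), Function.Injective φ →
    ∃ A : AddSubgroup (G ⧸ H), IsDirectSummand A ∧ IsEssentialIn φ.range A

/-- The torsion-free rank: the supremum of the cardinalities of the `ℤ`-linearly independent
subsets. -/
noncomputable def torsionFreeRank (G : Type*) [AddCommGroup G] : Cardinal :=
  Module.rank ℤ G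

/-- The `p`-rank: the dimension over `ℤ / p` of the `p`-socle `{x | p x = 0}`. -/
noncomputable def pRank (p : ℕ) (A : Type*) [AddCommGroup A] : Cardinal :=
  letI : Module (ZMod p) (AddSubgroup.torsionBy A (p : ℤ)) := AddSubgroup.torsionBy.zmodModule
  Module.rank (ZMod p) (AddSubgroup.torsionBy A (p : ℤ))

/-- `A` is `p`-divisible: `p A = A`. -/
def IsPDivisible (p : ℕ) (A : Type*) [AddCommGroup A] : Prop :=
  ∀ x : A, ∃ y : A, p • y = x

/-- `A` is divisible: `n A = A` for every positive integer `n`. -/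
def IsDivisibleGroup (A : Type*) [AddCommGroup A] : Prop :=
  ∀ n : ℕ, 0 < n → ∀ x : A, ∃ y : A, n • y = x

universe u v w

/-! The notion depends only on a surjection `f : G → X` and an injection `φ : G → X`: the image of
`φ` must be essential in the kernel of an idempotent of `X`.

Sufficiency. In finite rank, additivity of rank makes `ker f` and `X / φ(G)` torsion. The idempotent
can then be assembled from one projection onto a `p`-primary subgroup for each `p`
(`hasEssentialProjection_of_primary`). If `T_p` has finite rank, counting socles shows that `φ`
already hits all of `X[p]`, and the zero projection works. Otherwise the projection that `T_p`
provides on `X_p`, together with zero on `φ(G)`, is defined on `X_p + φ(G)`. It extends to `X`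
because `X_p` is divisible, or because `X` is torsion prime to `p` modulo `X_p + φ(G)`, which is
what `p`-divisibility of `G/T` gives.

Necessity rests on one obstruction, `HasEssentialProjection.eq_zero_of_eq_pow_nsmul`. Suppose `G ≅
ℤ/p^n × G'`, that `G'` maps onto `Y`, and that `y : G → Y` is injective. If every element of `Y[p]`
comes from `ker c` for some `c : G → ℤ/p^n`, then `c` must vanish wherever `y` is divisible by
`p^n`. It is used twice. With `Y` built from a countable sum of Prüfer groups, it excludes cyclic
`p`-summands of unbounded order. Hence `T_p` is divisible plus bounded and splits off as `G = T_p ⊕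
K`, so that `T_p` inherits the property. If moreover `T_p` has infinite rank and is not divisible,
it has room to lose a cyclic summand (`HasSlackSummand`). Pairing this with multiplication by `p^n`
on `K` then kills every homomorphism `K → ℤ/p^n`, so `K = pK`. -/

/-- The image of `φ` is essential in the kernel of an idempotent endomorphism. -/
def HasEssentialProjection {G : Type u} {X : Type v} [AddCommGroup G] [AddCommGroup X]
    (φ : G →+ X) : Prop :=
  ∃ π : X →+ X, (∀ x, π (π x) = π x) ∧ (∀ g, π (φ g) = 0) ∧
    ∀ x, π x = 0 → x ≠ 0 → ∃ n : ℤ, n • x ≠ 0 ∧ ∃ g, φ g = n • x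

/-! ### Direct summands as kernels of idempotents. -/

section Reformulation

variable {G : Type u} {X : Type v} {Y : Type w} [AddCommGroup G] [AddCommGroup X] [AddCommGroup Y]

/-- A summand with a chosen complement is the kernel of the projection onto that complement, and
essentiality need only be tested on cyclic subgroups. -/
theorem hasEssentialProjection_iff (φ : G →+ X) :
    HasEssentialProjection φ ↔
      ∃ A : AddSubgroup X, IsDirectSummand A ∧ IsEssentialIn φ.range A := by
  constructor
  · rintro ⟨π, hπ, hφ, hess⟩
    refine ⟨π.ker, ⟨π.range, ?_⟩, ?_, ?_⟩
    · refine ⟨AddSubgroup.disjoint_def.2 ?_, ?_⟩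
      · rintro x hx ⟨y, rfl⟩
        rw [← hπ]; exact hx
      · rw [codisjoint_iff, eq_top_iff]
        intro x _
        refine AddSubgroup.mem_sup.2 ⟨x - π x, ?_, π x, ⟨x, rfl⟩, by abel⟩
        simp [AddMonoidHom.mem_ker, hπ]
    · rintro _ ⟨g, rfl⟩
      exact hφ g
    · intro S hS hne
      obtain ⟨⟨x, hx⟩, h0⟩ := AddSubgroup.ne_bot_iff_exists_ne_zero.1 hne
      obtain ⟨n, hn, g, hg⟩ := hess x (hS hx) (by simpa using h0)
      intro h
      apply hn
      rw [← AddSubgroup.mem_bot, ← h]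
      exact ⟨⟨g, hg⟩, S.zsmul_mem hx n⟩
  · rintro ⟨A, ⟨B, hAB⟩, hle, hess⟩
    have hex : ∀ x : X, ∃ b : X, b ∈ B ∧ x - b ∈ A := fun x => by
      have : x ∈ A ⊔ B := by rw [hAB.sup_eq_top]; trivial
      obtain ⟨a, ha, b, hb, rfl⟩ := AddSubgroup.mem_sup.1 this
      exact ⟨b, hb, by simpa using ha⟩
    choose f hfB hfA using hex
    have huniq : ∀ x b, b ∈ B → x - b ∈ A → f x = b := fun x b hb ha => by
      have h1 : f x - b ∈ A := by
        have := A.sub_mem ha (hfA x)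
        simpa using this
      exact sub_eq_zero.1 (AddSubgroup.disjoint_def.1 hAB.disjoint h1 (B.sub_mem (hfB x) hb))
    let π : X →+ X := AddMonoidHom.mk' f fun x y => huniq _ _ (B.add_mem (hfB x) (hfB y)) (by
      have := A.add_mem (hfA x) (hfA y)
      rwa [add_sub_add_comm])
    have hker : ∀ x ∈ A, f x = 0 := fun x hx => huniq _ _ B.zero_mem (by simpa using hx)
    refine ⟨π, fun x => huniq _ _ (hfB x) (by simp [A.zero_mem]), fun g => hker _ (hle ⟨g, rfl⟩), ?_⟩
    intro x hx h0
    have hxA : x ∈ A := by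
      have := hfA x
      rwa [show f x = 0 from hx, sub_zero] at this
    have := hess (AddSubgroup.zmultiples x) (by simpa using hxA) (by simpa using h0)
    obtain ⟨y, hy⟩ := AddSubgroup.ne_bot_iff_exists_ne_zero.1 this
    obtain ⟨⟨g, hg⟩, n, hn⟩ := y.2
    refine ⟨n, ?_, g, ?_⟩
    · simp only at hn
      rw [hn]; simpa using hy
    · simp only at hn
      rw [hn, hg]

theorem HasEssentialProjection.of_addEquiv {φ : G →+ X} (e : X ≃+ Y)
    (h : HasEssentialProjection (e.toAddMonoidHom.comp φ)) : HasEssentialProjection φ := by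
  obtain ⟨π, h1, h2, h3⟩ := h
  refine ⟨e.symm.toAddMonoidHom.comp (π.comp e.toAddMonoidHom), fun x => by simp [h1],
    fun g => ?_, fun x hx h0 => ?_⟩
  · have := h2 g
    simp at this
    simp [this]
  · obtain ⟨n, hn, g, hg⟩ := h3 (e x) (by simpa using hx) (by simpa using h0)
    refine ⟨n, fun h => hn (by rw [← map_zsmul, h, map_zero]), g, e.injective ?_⟩
    simpa using hg

/-- Frees the later constructions from quotients: any surjection out of `G` can play the role of `G
→ G/H`. -/
theorem IsSemiGeneralizedCoBassian.hasEssentialProjection (hG : IsSemiGeneralizedCoBassian G)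
    (f φ : G →+ X) (hf : Function.Surjective f) (hφ : Function.Injective φ) :
    HasEssentialProjection φ := by
  let e := QuotientAddGroup.quotientKerEquivOfSurjective f hf
  have := (hasEssentialProjection_iff _).2
    (hG f.ker (e.symm.toAddMonoidHom.comp φ) (e.symm.injective.comp hφ))
  exact this.of_addEquiv e.symm

theorem isSemiGeneralizedCoBassian_iff : IsSemiGeneralizedCoBassian G ↔
    ∀ (H : AddSubgroup G) (φ : G →+ G ⧸ H), Function.Injective φ → HasEssentialProjection φ := by
  simp only [IsSemiGeneralizedCoBassian, hasEssentialProjection_iff]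

end Reformulation

/-! ### Extending homomorphisms into divisible groups and into `p`-groups. -/

section Extension

variable {F : Type u} {X : Type v} {D : Type w} [AddCommGroup F] [AddCommGroup X] [AddCommGroup D]

theorem IsDivisibleGroup.exists_extension (hD : IsDivisibleGroup D) (β : F →+ X) (δ : F →+ D)
    (h : ∀ x, β x = 0 → δ x = 0) : ∃ d : X →+ D, ∀ x, d (β x) = δ x := by
  classical
  let _ : DivisibleBy D ℤ :=
    divisibleByOfSMulRightSurj D ℤ fun {n} hn x => by
      obtain ⟨y, hy⟩ := hD n.natAbs (Int.natAbs_pos.2 hn) x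
      rcases Int.natAbs_eq n with h | h
      · exact ⟨y, show n • y = x by rw [← hy, ← natCast_zsmul, ← h]⟩
      · exact ⟨-y, show n • -y = x by
          rw [← hy, ← natCast_zsmul, show (n.natAbs : ℤ) = -n by omega, neg_smul, smul_neg]⟩
  obtain ⟨d, hd⟩ := (Module.Baer.of_divisible D).extension_property_addMonoidHom
    (QuotientAddGroup.kerLift β) (QuotientAddGroup.kerLift_injective β)
    (QuotientAddGroup.lift β.ker δ fun x hx => h x hx)
  exact ⟨d, fun x => DFunLike.congr_fun hd (QuotientAddGroup.mk x)⟩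

theorem exists_coprime_smul_eq {p : ℕ} {x : D} {k m : ℕ} (hk : p ^ k • x = 0)
    (hm : m.Coprime p) : ∃ u : ℤ, (m : ℤ) • u • x = x := by
  have hc : IsCoprime (m : ℤ) ((p ^ k : ℕ) : ℤ) := Nat.isCoprime_iff_coprime.2 (hm.pow_right k)
  obtain ⟨a, b, hab⟩ := hc
  refine ⟨a, ?_⟩
  calc (m : ℤ) • a • x = (a * m + b * (p ^ k : ℕ)) • x := by
        rw [add_smul, mul_smul b, natCast_zsmul x (p ^ k), hk, smul_zero, add_zero, smul_smul, mul_comm]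
    _ = x := by rw [hab, one_smul]

theorem eq_zero_of_coprime_smul {p : ℕ} {x : D} {k m : ℕ} (hk : p ^ k • x = 0)
    (hm : m.Coprime p) (h : m • x = 0) : x = 0 := by
  obtain ⟨u, hu⟩ := exists_coprime_smul_eq hk hm
  rw [← hu, smul_comm, natCast_zsmul, h, smul_zero]

/-- Multiplication by `m` prime to `p` is bijective on a `p`-group, so the value at `x` is forced to
be `δ f` divided by `m`. -/
theorem exists_extension_of_coprime {p : ℕ} (hD : ∀ x : D, ∃ k : ℕ, p ^ k • x = 0)
    (β : F →+ X) (δ : F →+ D) (h : ∀ x, β x = 0 → δ x = 0)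
    (hX : ∀ x : X, ∃ m : ℕ, m.Coprime p ∧ ∃ f, β f = m • x) :
    ∃ d : X →+ D, ∀ x, d (β x) = δ x := by
  let R : X → D → Prop := fun x y => ∃ m : ℕ, m.Coprime p ∧ ∃ f, β f = m • x ∧ δ f = m • y
  have hex : ∀ x, ∃ y, R x y := fun x => by
    obtain ⟨m, hm, f, hf⟩ := hX x
    obtain ⟨k, hk⟩ := hD (δ f)
    obtain ⟨a, ha⟩ := exists_coprime_smul_eq hk hm
    exact ⟨a • δ f, m, hm, f, hf, by rw [← natCast_zsmul, ha]⟩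
  have huniq : ∀ x y y', R x y → R x y' → y = y' := by
    rintro x y y' ⟨m, hm, f, hf, hy⟩ ⟨m', hm', f', hf', hy'⟩
    have h0 : δ (m' • f - m • f') = 0 := h _ (by
      rw [map_sub, map_nsmul, map_nsmul, hf, hf', smul_comm, sub_self])
    obtain ⟨k, hk⟩ := hD (y - y')
    refine sub_eq_zero.1 (eq_zero_of_coprime_smul (m := m * m') hk (Nat.Coprime.mul_left hm hm') ?_)
    rw [map_sub, map_nsmul, map_nsmul, hy, hy', smul_comm, ← smul_sub, ← smul_sub, smul_smul] at h0
    exact h0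
  choose d hd using hex
  refine ⟨AddMonoidHom.mk' d fun x y => ?_, fun x => ?_⟩
  · obtain ⟨m, hm, f, hf, hy⟩ := hd x
    obtain ⟨m', hm', f', hf', hy'⟩ := hd y
    refine huniq _ _ _ (hd _) ⟨m * m', Nat.Coprime.mul_left hm hm', m' • f + m • f', ?_, ?_⟩
    · rw [map_add, map_nsmul, map_nsmul, hf, hf', smul_add, smul_smul, smul_smul, mul_comm m']
    · rw [map_add, map_nsmul, map_nsmul, hy, hy', smul_add, smul_smul, smul_smul, mul_comm m']
  · exact huniq _ _ _ (hd _) ⟨1, Nat.coprime_one_left p, x, by simp, by simp⟩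

end Extension

/-! ### Assembling the primary projections. -/

section Combine

variable {G : Type u} {X : Type v} [AddCommGroup G] [AddCommGroup X]

/-- A projection onto a `p`-primary subgroup which kills the image of `φ`, and whose kernel has its
`p`-socle inside the image of `φ`. -/
def HasPrimaryProjection (p : ℕ) (φ : G →+ X) : Prop :=
  ∃ π : X →+ X, (∀ x, ∃ k : ℕ, p ^ k • π x = 0) ∧ (∀ x, π (π x) = π x) ∧ (∀ g, π (φ g) = 0) ∧
    ∀ x, p • x = 0 → π x = 0 → ∃ g, φ g = x

theorem hasEssentialProjection_of_primary {φ : G →+ X}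
    (hX : ∀ x, ∃ n : ℕ, 0 < n ∧ ∃ g, φ g = n • x)
    (h : ∀ p : ℕ, p.Prime → HasPrimaryProjection p φ) : HasEssentialProjection φ := by
  have h' : ∀ p : Nat.Primes, HasPrimaryProjection p φ := fun p => h p p.2
  choose π hp hi hφ hs using h'
  -- If `n • x` lies in the image of `φ`, then `n` kills `π p x`, which is `p`-torsion; so only
  -- primes dividing `n` contribute.
  have hfin : ∀ x, (Function.support fun p => π p x).Finite := fun x => by
    obtain ⟨n, hn, g, hg⟩ := hX x
    refine (((Nat.divisors n).finite_toSet.preimage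
      (f := fun p : Nat.Primes => (p : ℕ)) Nat.Primes.coe_nat_injective.injOn)).subset ?_
    intro p hx
    simp only [Set.mem_preimage, Finset.mem_coe, Nat.mem_divisors]
    refine ⟨by_contra fun hd => hx ?_, hn.ne'⟩
    obtain ⟨k, hk⟩ := hp p x
    refine eq_zero_of_coprime_smul (m := n) hk ?_ ?_
    · exact ((Nat.Prime.coprime_iff_not_dvd p.2).2 hd).symm
    · rw [← map_nsmul, ← hg, hφ]
  have horth : ∀ p q x, p ≠ q → π p (π q x) = 0 := fun p q x hpq => by
    obtain ⟨k, hk⟩ := hp p (π q x)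
    obtain ⟨l, hl⟩ := hp q x
    refine eq_zero_of_coprime_smul (m := (q : ℕ) ^ l) hk ?_ (by rw [← map_nsmul, hl, map_zero])
    exact Nat.Coprime.pow_left _ ((Nat.coprime_primes q.2 p.2).2 fun h => hpq (Subtype.ext h.symm))
  let P : X →+ X := AddMonoidHom.mk' (fun x => ∑ᶠ p, π p x) fun x y => by
    simp only [map_add]
    exact finsum_add_distrib (hfin x) (hfin y)
  have hP : ∀ q x, π q (P x) = π q x := fun q x => by
    change π q (∑ᶠ p, π p x) = _
    rw [AddMonoidHom.map_finsum _ (hfin x), finsum_eq_single _ q fun p hpq => horth _ _ _ hpq.symm,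
      hi]
  refine ⟨P, fun x => ?_, fun g => ?_, fun x hx h0 => ?_⟩
  · change ∑ᶠ p, π p (P x) = ∑ᶠ p, π p x
    simp only [hP]
  · change ∑ᶠ p, π p (φ g) = 0
    simp [hφ]
  · obtain ⟨n, hn, g, hg⟩ := hX x
    -- If `n • x = 0`, a multiple of `x` has prime order `p` and is killed by `π p`, so the socle
    -- condition at `p` puts it in the image.
    by_cases hnx : n • x = 0
    · have hx1 : addOrderOf x ≠ 1 := fun h => h0 (AddMonoid.addOrderOf_eq_one_iff.1 h)
      have hpos : 0 < addOrderOf x := addOrderOf_pos_iff.2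
        (isOfFinAddOrder_iff_nsmul_eq_zero.2 ⟨n, hn, hnx⟩)
      obtain ⟨p, hpp, m, hm⟩ := Nat.exists_prime_and_dvd hx1
      have hm0 : 0 < m := Nat.pos_of_ne_zero (by rintro rfl; rw [hm] at hpos; simp at hpos)
      let q : Nat.Primes := ⟨p, hpp⟩
      have hq : π q x = 0 := by rw [← hP, hx, map_zero]
      refine ⟨m, fun h => ?_, ?_⟩
      · have := Nat.le_of_dvd hm0 (addOrderOf_dvd_of_nsmul_eq_zero (by simpa using h))
        have := hpp.two_le
        nlinarith
      · refine hs q _ ?_ ?_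
        · rw [natCast_zsmul, smul_smul, show (q : ℕ) * m = addOrderOf x from hm.symm,
            addOrderOf_nsmul_eq_zero]
        · rw [map_zsmul, hq, smul_zero]
    · exact ⟨n, by simpa using hnx, g, by simpa using hg⟩

end Combine

/-! ### Counting socles. -/

section Socle

variable {G : Type u} {X : Type v} [AddCommGroup G] [AddCommGroup X]

theorem card_socle_eq_index (p : ℕ) [Finite G] :
    Nat.card (nsmulAddMonoidHom (α := G) p).ker = (nsmulAddMonoidHom (α := G) p).range.index := by
  have h1 := AddSubgroup.card_mul_index (nsmulAddMonoidHom (α := G) p).ker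
  have h2 := AddSubgroup.card_mul_index (nsmulAddMonoidHom (α := G) p).range
  rw [AddSubgroup.index_ker, mul_comm, ← h2] at h1
  exact Nat.eq_of_mul_eq_mul_left Nat.card_pos h1

/-- For finite groups the socle is as large as `G/pG`, and `G/pG`, unlike the socle, visibly passes
to quotients. -/
theorem card_socle_le_of_surjective (p : ℕ) [Finite G] [Finite X] (f : G →+ X)
    (hf : Function.Surjective f) :
    Nat.card (nsmulAddMonoidHom (α := X) p).ker ≤ Nat.card (nsmulAddMonoidHom (α := G) p).ker := by
  rw [card_socle_eq_index, card_socle_eq_index, ← AddSubgroup.index_comap_of_surjective _ hf]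
  refine Nat.le_of_dvd (Nat.pos_of_ne_zero AddSubgroup.index_ne_zero_of_finite)
    (AddSubgroup.index_dvd_of_le ?_)
  rintro _ ⟨g, rfl⟩
  exact ⟨f g, by simp⟩

/-- If the kernel of a surjection `f` is torsion, the `p`-socle does not grow along `f`. -/
theorem card_le_of_subset_socle {p : ℕ} (hp : 0 < p) (f : G →+ X) (hf : Function.Surjective f)
    (hker : ∀ g, f g = 0 → ∃ n : ℕ, 0 < n ∧ n • g = 0) (hfin : {g : G | p • g = 0}.Finite)
    (s : Finset X) (hs : ∀ x ∈ s, p • x = 0) : s.card ≤ {g : G | p • g = 0}.ncard := by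
  classical
  choose l hl using hf
  let F : AddSubgroup G := AddSubgroup.closure (s.image l : Finset G)
  have htor : ∀ g ∈ F, IsOfFinAddOrder g := by
    intro g hg
    induction hg using AddSubgroup.closure_induction with
    | mem x hx =>
      obtain ⟨y, hy, rfl⟩ := Finset.mem_image.1 (Finset.mem_coe.1 hx)
      obtain ⟨n, hn, h⟩ := hker (p • l y) (by rw [map_nsmul, hl, hs y hy])
      exact isOfFinAddOrder_iff_nsmul_eq_zero.2 ⟨n * p, by positivity, by rwa [mul_smul]⟩
    | zero => exact IsOfFinAddOrder.zero
    | add x y _ _ hx hy => exact hx.add hy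
    | neg x _ hx => exact hx.neg
  have : AddGroup.FG F := (AddGroup.fg_iff_addSubgroup_fg F).2 ⟨s.image l, rfl⟩
  have : Finite F := AddCommGroup.finite_of_fg_isAddTorsion F fun g => by
    obtain ⟨n, hn, h⟩ := isOfFinAddOrder_iff_nsmul_eq_zero.1 (htor g g.2)
    exact isOfFinAddOrder_iff_nsmul_eq_zero.2 ⟨n, hn, Subtype.ext (by simpa using h)⟩
  let α := f.addSubgroupMap F
  have hα : Function.Surjective α := f.addSubgroupMap_surjective F
  have : Finite (F.map f) := Finite.of_surjective _ hα
  have hsF : ∀ x ∈ s, x ∈ F.map f := fun x hx =>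
    ⟨l x, AddSubgroup.subset_closure (Finset.mem_coe.2 (Finset.mem_image_of_mem l hx)), hl x⟩
  calc s.card = Nat.card s := by simp
    _ ≤ Nat.card (nsmulAddMonoidHom (α := F.map f) p).ker :=
        Nat.card_le_card_of_injective
          (fun x => ⟨⟨x, hsF x x.2⟩, Subtype.ext (by simpa using hs x x.2)⟩)
          fun _ _ h => Subtype.ext (congrArg (fun z => z.1.1) h)
    _ ≤ Nat.card (nsmulAddMonoidHom (α := F) p).ker := card_socle_le_of_surjective p α hα
    _ ≤ Nat.card {g : G | p • g = 0} :=
        have := hfin.to_subtype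
        Nat.card_le_card_of_injective
          (fun x => ⟨x.1.1, by simpa using congrArg Subtype.val (AddMonoidHom.mem_ker.1 x.2)⟩)
          fun _ _ h => Subtype.ext (Subtype.ext (congrArg (fun z => z.1) h))
    _ = _ := Nat.card_coe_set_eq _

theorem exists_eq_of_finite_socle {p : ℕ} (hp : 0 < p) (f φ : G →+ X)
    (hf : Function.Surjective f) (hφ : Function.Injective φ)
    (hker : ∀ g, f g = 0 → ∃ n : ℕ, 0 < n ∧ n • g = 0) (hfin : {g : G | p • g = 0}.Finite)
    (x : X) (hx : p • x = 0) : ∃ g, φ g = x := by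
  classical
  by_contra hne
  have hmem : x ∉ hfin.toFinset.image φ := by
    rw [Finset.mem_image]
    rintro ⟨g, -, hg⟩
    exact hne ⟨g, hg⟩
  -- Pigeonhole: `φ` embeds the socle of `G`, so an `x` outside the image would be one socle element
  -- too many in `X`.
  have h := card_le_of_subset_socle hp f hf hker hfin (insert x (hfin.toFinset.image φ)) (by
    intro y hy
    rcases Finset.mem_insert.1 hy with rfl | hy
    · exact hx
    · obtain ⟨g, hg, rfl⟩ := Finset.mem_image.1 hy
      rw [← map_nsmul, show p • g = 0 by simpa using hg, map_zero])
  rw [Finset.card_insert_of_notMem hmem, Finset.card_image_of_injective _ hφ,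
    Set.ncard_eq_toFinset_card _ hfin] at h
  omega

end Socle

/-! ### One prime at a time: sufficiency of (a), (b) and (c). -/

section Primary

open AddCommGroup

variable {G : Type u} {X : Type v} [AddCommGroup G] [AddCommGroup X]

/-- The homomorphism induced on `p`-primary components. -/
def primaryMap (p : ℕ) (f : G →+ X) : primaryComponent G p →+ primaryComponent X p :=
  (f.comp (primaryComponent G p).subtype).codRestrict _ fun g => by
    obtain ⟨k, hk⟩ := mem_primaryComponent.1 g.2
    exact mem_primaryComponent.2 ⟨k, by simp [← map_nsmul, hk]⟩

@[simp]
theorem coe_primaryMap (p : ℕ) (f : G →+ X) (g : primaryComponent G p) :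
    (primaryMap p f g : X) = f g := rfl

theorem primaryMap_injective (p : ℕ) {f : G →+ X} (hf : Function.Injective f) :
    Function.Injective (primaryMap p f) := fun _ _ h =>
  Subtype.ext (hf (congrArg Subtype.val h))

theorem primaryMap_surjective {p : ℕ} (hp : p.Prime) {f : G →+ X} (hf : Function.Surjective f)
    (hker : ∀ g, f g = 0 → ∃ n : ℕ, 0 < n ∧ n • g = 0) :
    Function.Surjective (primaryMap p f) := by
  rintro ⟨x, hx⟩
  obtain ⟨k, hk⟩ := mem_primaryComponent.1 hx
  obtain ⟨g, rfl⟩ := hf x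
  obtain ⟨n, hn, hng⟩ := hker (p ^ k • g) (by rw [map_nsmul, hk])
  obtain ⟨j, m, hm, rfl⟩ := Nat.exists_eq_pow_mul_and_not_dvd hn.ne' p hp.ne_one
  obtain ⟨u, hu⟩ := exists_coprime_smul_eq hk ((Nat.Prime.coprime_iff_not_dvd hp).2 hm).symm
  refine ⟨⟨(m : ℤ) • u • g, mem_primaryComponent.2 ⟨j + k, ?_⟩⟩, Subtype.ext ?_⟩
  · have : p ^ (j + k) • (m : ℤ) • u • g = u • ((p ^ j * m) • p ^ k • g) := by
      simp only [← natCast_zsmul, smul_smul]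
      congr 1
      push_cast
      ring
    rw [this, hng, smul_zero]
  · simpa using hu

theorem mem_primaryComponent_of_injective {p : ℕ} {f : G →+ X} (hf : Function.Injective f) {g : G}
    (h : f g ∈ primaryComponent X p) : g ∈ primaryComponent G p := by
  obtain ⟨k, hk⟩ := mem_primaryComponent.1 h
  exact mem_primaryComponent.2 ⟨k, hf (by rw [map_nsmul, hk, map_zero])⟩

/-- On the overlap `X_p ∩ φ(G) = φ(T_p)` the projection `q` vanishes, so `q` on `X_p` and zero on
`φ(G)` agree there; `hext` carries the glued map to all of `X`. -/
theorem hasPrimaryProjection_of_extension {p : ℕ} (hp : p.Prime) {φ : G →+ X}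
    (hφ : Function.Injective φ) (hT : HasEssentialProjection (primaryMap p φ))
    (hext : ∀ δ : primaryComponent X p × G →+ primaryComponent X p,
      (∀ y, (primaryComponent X p).subtype.coprod φ y = 0 → δ y = 0) →
      ∃ d : X →+ primaryComponent X p, ∀ y, d ((primaryComponent X p).subtype.coprod φ y) = δ y) :
    HasPrimaryProjection p φ := by
  obtain ⟨q, hq, hqφ, hqe⟩ := hT
  obtain ⟨d, hd⟩ := hext (q.comp (AddMonoidHom.fst _ _)) (by
    rintro ⟨x, g⟩ h
    have hx : φ (-g) = x := by
      simp only [AddMonoidHom.coprod_apply, AddSubgroup.coe_subtype] at h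
      rw [map_neg, neg_eq_iff_add_eq_zero, add_comm, h]
    have hm := mem_primaryComponent_of_injective hφ (hx ▸ x.2)
    have he : primaryMap p φ ⟨-g, hm⟩ = x := Subtype.ext hx
    rw [AddMonoidHom.comp_apply, AddMonoidHom.coe_fst, ← he]
    exact hqφ _)
  have hd1 : ∀ x : primaryComponent X p, d x = q x := fun x => by simpa using hd (x, 0)
  have hd2 : ∀ g, d (φ g) = 0 := fun g => by simpa using hd (0, g)
  refine ⟨(primaryComponent X p).subtype.comp (q.comp d), fun x => ?_, fun x => ?_, fun g => ?_,
    fun x hx h0 => ?_⟩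
  · exact mem_primaryComponent.1 (q (d x)).2
  · simp [hd1, hq]
  · simp [hd2]
  · rcases eq_or_ne x 0 with rfl | hx0
    · exact ⟨0, map_zero _⟩
    have hxp : x ∈ primaryComponent X p := mem_primaryComponent.2 ⟨1, by simpa using hx⟩
    have hqx : q ⟨x, hxp⟩ = 0 := by
      have : q (d x) = 0 := Subtype.ext h0
      rwa [show d x = q ⟨x, hxp⟩ from hd1 ⟨x, hxp⟩, hq] at this
    obtain ⟨n, hn, g, hg⟩ := hqe _ hqx (fun h => hx0 (congrArg Subtype.val h))
    have hcop : (n.natAbs).Coprime p := by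
      refine ((Nat.Prime.coprime_iff_not_dvd hp).2 fun h => hn ?_).symm
      obtain ⟨m, rfl⟩ := Int.natCast_dvd.2 h
      rw [mul_comm, mul_smul, natCast_zsmul]
      convert smul_zero m
      exact Subtype.ext hx
    obtain ⟨u, hu⟩ := exists_coprime_smul_eq (k := 1) (by simpa using hx) hcop
    have hg' : φ g = n • x := congrArg Subtype.val hg
    rcases Int.natAbs_eq n with h | h
    · refine ⟨u • (g : G), ?_⟩
      rw [map_zsmul, hg', smul_comm, h, hu]
    · refine ⟨-(u • (g : G)), ?_⟩
      rw [map_neg, map_zsmul, hg', smul_comm, h, neg_smul, neg_neg, hu]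

theorem hasPrimaryProjection_of_isDivisible {p : ℕ} (hp : p.Prime) {f φ : G →+ X}
    (hf : Function.Surjective f) (hφ : Function.Injective φ)
    (hker : ∀ g, f g = 0 → ∃ n : ℕ, 0 < n ∧ n • g = 0)
    (hT : HasEssentialProjection (primaryMap p φ))
    (hD : IsDivisibleGroup (primaryComponent G p)) : HasPrimaryProjection p φ := by
  have hDX : IsDivisibleGroup (primaryComponent X p) := fun n hn x => by
    obtain ⟨g, rfl⟩ := primaryMap_surjective hp hf hker x
    obtain ⟨g', rfl⟩ := hD n hn g
    exact ⟨primaryMap p f g', (map_nsmul _ _ _).symm⟩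
  exact hasPrimaryProjection_of_extension hp hφ hT fun δ hδ => hDX.exists_extension _ δ hδ

theorem hasPrimaryProjection_of_isPDivisible {p : ℕ} (hp : p.Prime) {φ : G →+ X}
    (hφ : Function.Injective φ) (hX : ∀ x, ∃ n : ℕ, 0 < n ∧ ∃ g, φ g = n • x)
    (hT : HasEssentialProjection (primaryMap p φ))
    (hD : IsPDivisible p (G ⧸ torsion G)) : HasPrimaryProjection p φ := by
  have hpow : ∀ (j : ℕ) (g : G), ∃ g' : G, g - p ^ j • g' ∈ torsion G := fun j => by
    induction j with
    | zero => exact fun g => ⟨g, by simp⟩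
    | succ j ih =>
      intro g
      obtain ⟨g₁, h₁⟩ := ih g
      obtain ⟨y, hy⟩ := hD (g₁ : G ⧸ torsion G)
      obtain ⟨g₂, rfl⟩ := QuotientAddGroup.mk_surjective y
      have h₂ : g₁ - p • g₂ ∈ torsion G := by
        rw [← QuotientAddGroup.eq_zero_iff]
        simpa [sub_eq_zero] using hy.symm
      refine ⟨g₂, ?_⟩
      have := AddSubgroup.add_mem _ h₁ (AddSubgroup.nsmul_mem _ h₂ (p ^ j))
      rwa [smul_sub, smul_smul, ← pow_succ, sub_add_sub_cancel] at this
  refine hasPrimaryProjection_of_extension hp hφ hT fun δ hδ =>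
    exists_extension_of_coprime (p := p) (fun x => ?_) _ δ hδ fun x => ?_
  · obtain ⟨k, hk⟩ := mem_primaryComponent.1 x.2
    exact ⟨k, Subtype.ext hk⟩
  · obtain ⟨n, hn, g, hg⟩ := hX x
    obtain ⟨j, m, hm, rfl⟩ := Nat.exists_eq_pow_mul_and_not_dvd hn.ne' p hp.ne_one
    obtain ⟨g', hg'⟩ := hpow j g
    obtain ⟨N, hN, h0⟩ := isOfFinAddOrder_iff_nsmul_eq_zero.1 hg'
    obtain ⟨i, M, hM, rfl⟩ := Nat.exists_eq_pow_mul_and_not_dvd hN.ne' p hp.ne_one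
    -- Here `p ^ j • m • x = φ g`, and `p ^ i * M` kills `g - p ^ j • g'`. So `p ^ (i + j)` kills
    -- this element, and `M * m`, prime to `p`, carries `x` into `X_p + φ(G)`.
    have hy : M • (m • x - φ g') ∈ primaryComponent X p := mem_primaryComponent.2 ⟨i + j, by
      have h1 : φ ((p ^ i * M) • (g - p ^ j • g')) = 0 := by rw [h0, map_zero]
      rw [map_nsmul, map_sub, hg, map_nsmul, mul_smul (p ^ j), ← smul_sub, smul_smul] at h1
      rw [smul_smul, ← h1]
      congr 1
      ring⟩
    refine ⟨M * m, Nat.Coprime.mul_left ((Nat.Prime.coprime_iff_not_dvd hp).2 hM).symm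
      ((Nat.Prime.coprime_iff_not_dvd hp).2 hm).symm, (⟨_, hy⟩, M • g'), ?_⟩
    simp [smul_sub, mul_smul]

theorem pRank_lt_aleph0_iff {p : ℕ} (hp : p.Prime) {A : Type u} [AddCommGroup A] :
    pRank p A < ℵ₀ ↔ {a : A | p • a = 0}.Finite := by
  have : Fact p.Prime := ⟨hp⟩
  let _ : Module (ZMod p) (AddSubgroup.torsionBy A (p : ℤ)) := AddSubgroup.torsionBy.zmodModule
  have hset : {a : A | p • a = 0} = (AddSubgroup.torsionBy A (p : ℤ) : Set A) := by
    ext a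
    exact (by rw [natCast_zsmul] : p • a = 0 ↔ (p : ℤ) • a = 0).trans
      (Submodule.mem_torsionBy_iff _ _).symm
  rw [hset]
  change Module.rank (ZMod p) (AddSubgroup.torsionBy A (p : ℤ)) < ℵ₀ ↔ _
  rw [Module.rank_lt_aleph0_iff]
  constructor
  · intro h
    exact Module.finite_of_finite (ZMod p) (M := AddSubgroup.torsionBy A (p : ℤ))
  · intro h
    have : Finite (AddSubgroup.torsionBy A (p : ℤ)) := h
    exact Module.Finite.of_finite

theorem hasPrimaryProjection_of_pRank {p : ℕ} (hp : p.Prime) {f φ : G →+ X}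
    (hf : Function.Surjective f) (hφ : Function.Injective φ)
    (hker : ∀ g, f g = 0 → ∃ n : ℕ, 0 < n ∧ n • g = 0)
    (hr : pRank p (primaryComponent G p) < ℵ₀) : HasPrimaryProjection p φ := by
  refine ⟨0, fun x => ⟨0, by simp⟩, by simp, by simp, fun x hx _ => ?_⟩
  refine exists_eq_of_finite_socle hp.pos f φ hf hφ hker ?_ x hx
  refine (((pRank_lt_aleph0_iff hp).1 hr).image Subtype.val).subset fun g hg => ?_
  exact ⟨⟨g, mem_primaryComponent.2 ⟨1, by simpa using hg⟩⟩, Subtype.ext hg, rfl⟩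

end Primary

/-! ### Finite rank makes kernel and cokernel torsion. -/

section Rank

variable {G : Type u} [AddCommGroup G]

theorem exists_nsmul_eq_zero_of_rank_eq_zero (h : Module.rank ℤ G = 0) (x : G) :
    ∃ n : ℕ, 0 < n ∧ n • x = 0 := by
  obtain ⟨a, ha, hx⟩ := rank_eq_zero_iff.1 h x
  refine ⟨a.natAbs, Int.natAbs_pos.2 ha, ?_⟩
  rw [← natCast_zsmul]
  rcases Int.natAbs_eq a with h | h
  · rw [← h, hx]
  · rw [show (a.natAbs : ℤ) = -a by omega, neg_smul, hx, neg_zero]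

theorem isSemiGeneralizedCoBassian_of_primary (hG : torsionFreeRank G < ℵ₀)
    (h : ∀ p : ℕ, p.Prime → IsSemiGeneralizedCoBassian (AddCommGroup.primaryComponent G p) ∧
      (pRank p (AddCommGroup.primaryComponent G p) < ℵ₀ ∨
        IsDivisibleGroup (AddCommGroup.primaryComponent G p) ∨
        IsPDivisible p (G ⧸ AddCommGroup.torsion G))) : IsSemiGeneralizedCoBassian G := by
  rw [isSemiGeneralizedCoBassian_iff]
  intro H φ hφ
  have hG' : Module.rank ℤ G < ℵ₀ := hG
  -- The quotient has rank at most that of `G`, and the injection gives the reverse inequality; by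
  -- finiteness `H` and the cokernel of `φ` have rank zero.
  have h1 : Module.rank ℤ (G ⧸ H) + Module.rank ℤ H = Module.rank ℤ G :=
    rank_quotient_add_rank_of_isDomain (AddSubgroup.toIntSubmodule H)
  have h2 : Module.rank ℤ ((G ⧸ H) ⧸ φ.range) + Module.rank ℤ φ.range = Module.rank ℤ (G ⧸ H) :=
    rank_quotient_add_rank_of_isDomain (AddSubgroup.toIntSubmodule φ.range)
  have h3 : Module.rank ℤ φ.range = Module.rank ℤ G :=
    ((AddMonoidHom.ofInjective hφ).toIntLinearEquiv.rank_eq).symm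
  rw [h3] at h2
  obtain ⟨a, ha⟩ := Cardinal.lt_aleph0.1 hG'
  have hle : Module.rank ℤ (G ⧸ H) ≤ Module.rank ℤ G := h1 ▸ self_le_add_right _ _
  obtain ⟨b, hb⟩ := Cardinal.lt_aleph0.1 (hle.trans_lt hG')
  obtain ⟨c, hc⟩ := Cardinal.lt_aleph0.1 ((h1 ▸ self_le_add_left _ _ :
    Module.rank ℤ H ≤ Module.rank ℤ G).trans_lt hG')
  obtain ⟨d, hd⟩ := Cardinal.lt_aleph0.1 (((h2 ▸ self_le_add_right _ _ :
    Module.rank ℤ ((G ⧸ H) ⧸ φ.range) ≤ Module.rank ℤ (G ⧸ H)).trans hle).trans_lt hG')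
  rw [ha, hb, hc] at h1
  rw [ha, hb, hd] at h2
  norm_cast at h1 h2
  have hH := exists_nsmul_eq_zero_of_rank_eq_zero (G := H) (by rw [hc]; norm_cast; omega)
  have hQ := exists_nsmul_eq_zero_of_rank_eq_zero (G := (G ⧸ H) ⧸ φ.range)
    (by rw [hd]; norm_cast; omega)
  have hf := QuotientAddGroup.mk'_surjective H
  have hker : ∀ g, QuotientAddGroup.mk' H g = 0 → ∃ n : ℕ, 0 < n ∧ n • g = 0 := fun g hg => by
    obtain ⟨n, hn, h⟩ := hH ⟨g, (QuotientAddGroup.eq_zero_iff g).1 hg⟩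
    exact ⟨n, hn, congrArg Subtype.val h⟩
  have hX : ∀ x, ∃ n : ℕ, 0 < n ∧ ∃ g, φ g = n • x := fun x => by
    obtain ⟨n, hn, h⟩ := hQ (QuotientAddGroup.mk x)
    rw [← QuotientAddGroup.mk_nsmul, QuotientAddGroup.eq_zero_iff] at h
    exact ⟨n, hn, h⟩
  refine hasEssentialProjection_of_primary hX fun p hp => ?_
  obtain ⟨hT, hc⟩ := h p hp
  have hT' := hT.hasEssentialProjection _ _ (primaryMap_surjective hp hf hker)
    (primaryMap_injective p hφ)
  rcases hc with hr | hD | hD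
  · exact hasPrimaryProjection_of_pRank hp hf hφ hker hr
  · exact hasPrimaryProjection_of_isDivisible hp hf hφ hker hT' hD
  · exact hasPrimaryProjection_of_isPDivisible hp hφ hX hT' hD

end Rank

/-! ### The obstruction behind necessity. -/

section Obstruction

variable {G : Type u} {C : Type v} {Y : Type w} [AddCommGroup G] [AddCommGroup C] [AddCommGroup Y]

theorem exists_nsmul_ne_zero_of_pow_nsmul {p n : ℕ} {x : G} (hx : x ≠ 0) (h : p ^ n • x = 0) :
    ∃ m : ℕ, m • x ≠ 0 ∧ p • m • x = 0 := by
  classical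
  have hex : ∃ n, p ^ n • x = 0 := ⟨n, h⟩
  have hpos : 0 < Nat.find hex := (Nat.find_pos hex).2 (by simpa using hx)
  refine ⟨p ^ (Nat.find hex - 1), Nat.find_min hex (by omega), ?_⟩
  rw [smul_smul, ← pow_succ', Nat.sub_add_cancel hpos]
  exact Nat.find_spec hex

theorem HasEssentialProjection.eq_zero_of_eq_pow_nsmul {p n : ℕ} {c : G →+ C} {y : G →+ Y}
    (hC : ∀ a : C, p ^ n • a = 0) (hy : Function.Injective y)
    (hs : ∀ z : Y, p • z = 0 → ∃ g, y g = z ∧ c g = 0)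
    (h : HasEssentialProjection (c.prod y)) {g : G} {z : Y} (hg : y g = p ^ n • z) : c g = 0 := by
  obtain ⟨π, hi, hφ, hess⟩ := h
  -- Modulo the image of `φ`, which `π` kills, `(c g, 0)` is a `p ^ n`-th multiple; so its
  -- projection has zero `C`-coordinate.
  have ha : π (c g, 0) = p ^ n • π (0, -z) := by
    have h1 : ((c g, 0) : C × Y) = c.prod y g + p ^ n • ((0, -z) : C × Y) := by
      ext <;> simp [hg]
    rw [h1, map_add, hφ, zero_add, map_nsmul]
  -- Otherwise a multiple of order `p` lies in `0 × Y[p]`, hence in the image by `hs`; it would be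
  -- both fixed and killed by `π`.
  have hker : π (c g, 0) = 0 := by
    by_contra hne
    obtain ⟨m, hm, hpm⟩ := exists_nsmul_ne_zero_of_pow_nsmul (p := p) (n := n) hne (by
      rw [← map_nsmul, Prod.smul_mk, hC, smul_zero, Prod.mk_zero_zero, map_zero])
    have h1 : (m • π (c g, 0)).1 = 0 := by
      rw [ha, smul_comm, Prod.smul_fst, hC]
    obtain ⟨g', hg', hc'⟩ := hs (m • π (c g, 0)).2 (by rw [← Prod.smul_snd, hpm, Prod.snd_zero])
    have h2 : c.prod y g' = m • π (c g, 0) := Prod.ext (by rw [h1]; exact hc') hg'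
    apply hm
    rw [← hi, ← map_nsmul, ← h2, hφ]
  -- The image of `c.prod y` meets `C × 0` trivially because `y` is injective, so essentiality
  -- forces `c g = 0`.
  by_contra hne
  obtain ⟨m, hm, g', hg'⟩ := hess _ hker (fun h => hne (congrArg Prod.fst h))
  have h0 : g' = 0 := (injective_iff_map_eq_zero y).1 hy g' (by
    simpa using congrArg Prod.snd hg')
  exact hm (by rw [← hg', h0, map_zero])

theorem IsSemiGeneralizedCoBassian.eq_zero_of_eq_pow_nsmul {G' : Type v} [AddCommGroup G']
    {p n : ℕ} (hG : IsSemiGeneralizedCoBassian G) (e : G ≃+ ZMod (p ^ n) × G') {s : G' →+ Y}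
    (hs : Function.Surjective s) {c : G →+ ZMod (p ^ n)} {y : G →+ Y} (hy : Function.Injective y)
    (hsoc : ∀ z : Y, p • z = 0 → ∃ g, y g = z ∧ c g = 0) {g : G} {z : Y}
    (hg : y g = p ^ n • z) : c g = 0 := by
  have hinj : Function.Injective (c.prod y) := fun a b h => hy (congrArg Prod.snd h)
  have hsurj : Function.Surjective
      (((AddMonoidHom.id (ZMod (p ^ n))).prodMap s).comp e.toAddMonoidHom) := by
    have : Function.Surjective ((AddMonoidHom.id (ZMod (p ^ n))).prodMap s) := by
      rw [AddMonoidHom.coe_prodMap]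
      exact Function.surjective_id.prodMap hs
    exact this.comp e.surjective
  refine (hG.hasEssentialProjection _ _ hsurj hinj).eq_zero_of_eq_pow_nsmul (p := p) (n := n)
    (fun a => ?_) hy hsoc hg
  rw [nsmul_eq_mul, ZMod.natCast_self, zero_mul]

end Obstruction

/-! ### Splitting off homocyclic summands. -/

section Summand

variable {M : Type u} [AddCommGroup M]

/-- Take `K` maximal among subgroups that contain `p ^ (k + 1) M` and avoid `B`. The quotient by `B
+ K` is killed by `p ^ (k + 1)`; maximality shows that it has no `p`-torsion, so it is zero. -/
theorem exists_isCompl_of_homocyclic {p k : ℕ} (hp : p.Prime) (B : AddSubgroup M)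
    (h1 : ∀ x, p ^ (k + 1) • x ∈ B → p ^ (k + 1) • x = 0)
    (h2 : ∀ b ∈ B, p ^ k • b = 0 → ∃ b' ∈ B, b = p • b') : ∃ K : AddSubgroup M, IsCompl B K := by
  let R := (nsmulAddMonoidHom (α := M) (p ^ (k + 1))).range
  obtain ⟨K, hRK, hK⟩ := zorn_le_nonempty₀ {K : AddSubgroup M | R ≤ K ∧ Disjoint B K}
    (fun c hc hchain K₀ hK₀ => by
      refine ⟨sSup c, ⟨(hc hK₀).1.trans (le_sSup hK₀), ?_⟩, fun K hK => le_sSup hK⟩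
      rw [AddSubgroup.disjoint_def]
      intro x hx hxs
      obtain ⟨K, hKc, hxK⟩ := (AddSubgroup.mem_sSup_of_directedOn ⟨K₀, hK₀⟩ hchain.directedOn).1 hxs
      exact AddSubgroup.disjoint_def.1 (hc hKc).2 hx hxK) R
    ⟨le_rfl, AddSubgroup.disjoint_def.2 (by rintro _ hx ⟨x, rfl⟩; exact h1 x hx)⟩
  have hdis := hK.prop.2
  have hstep : ∀ x, p • x ∈ B ⊔ K → x ∈ B ⊔ K := fun x hx => by
    obtain ⟨b, hb, y, hy, hby⟩ := AddSubgroup.mem_sup.1 hx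
    have hpb : p ^ k • b = 0 := by
      refine AddSubgroup.disjoint_def.1 hdis (B.nsmul_mem hb _) ?_
      have h3 : p ^ k • b = p ^ (k + 1) • x - p ^ k • y := by
        rw [pow_succ, mul_smul, ← hby, smul_add, add_sub_cancel_right]
      rw [h3]
      exact K.sub_mem (hK.prop.1 ⟨x, rfl⟩) (K.nsmul_mem hy _)
    obtain ⟨b', hb', rfl⟩ := h2 b hb hpb
    have hpx : p • (x - b') = y := by rw [smul_sub, ← hby, add_sub_cancel_left]
    suffices h : x - b' ∈ B ⊔ K by
      have := (B ⊔ K).add_mem h (AddSubgroup.mem_sup_left hb')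
      rwa [sub_add_cancel] at this
    by_cases hd : Disjoint B (K ⊔ AddSubgroup.zmultiples (x - b'))
    · have hle := hK.le_of_ge (y := K ⊔ AddSubgroup.zmultiples (x - b'))
        ⟨hK.prop.1.trans le_sup_left, hd⟩ le_sup_left
      exact AddSubgroup.mem_sup_right (hle (AddSubgroup.mem_sup_right
        (AddSubgroup.mem_zmultiples _)))
    · rw [AddSubgroup.disjoint_def] at hd
      push Not at hd
      obtain ⟨b₁, hb₁, hb₂, hne⟩ := hd
      obtain ⟨y₁, hy₁, z, ⟨j, rfl⟩, hj⟩ := AddSubgroup.mem_sup.1 hb₂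
      simp only at hj
      have hpj : ¬ (p : ℤ) ∣ j := by
        rintro ⟨i, rfl⟩
        refine hne (AddSubgroup.disjoint_def.1 hdis hb₁ ?_)
        rw [← hj, mul_comm, mul_smul, natCast_zsmul, hpx]
        exact K.add_mem hy₁ (K.zsmul_mem hy _)
      obtain ⟨u, v, huv⟩ := (Int.isCoprime_iff_gcd_eq_one.2
        ((Nat.Prime.coprime_iff_not_dvd hp).2 fun h => hpj (Int.natCast_dvd.2 h)) :
          IsCoprime (p : ℤ) j)
      have hx' : x - b' = v • (b₁ - y₁) + u • y := by
        rw [← hj, ← hpx, add_sub_cancel_left, ← natCast_zsmul, smul_smul, smul_smul, ← add_smul,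
          add_comm, huv, one_smul]
      rw [hx']
      exact (B ⊔ K).add_mem ((B ⊔ K).zsmul_mem ((B ⊔ K).sub_mem (AddSubgroup.mem_sup_left hb₁)
        (AddSubgroup.mem_sup_right hy₁)) _) (AddSubgroup.mem_sup_right (K.zsmul_mem hy _))
  refine ⟨K, hdis, codisjoint_iff.2 (eq_top_iff.2 fun x _ => ?_)⟩
  have hpow : ∀ (j : ℕ) (x : M), p ^ j • x ∈ B ⊔ K → x ∈ B ⊔ K := fun j => by
    induction j with
    | zero => simp
    | succ j ih =>
      intro x hx
      exact ih x (hstep _ (by rwa [smul_smul, ← pow_succ']))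
  exact hpow (k + 1) x (AddSubgroup.mem_sup_right (hK.prop.1 ⟨x, rfl⟩))

/-- A group is the product of two complementary subgroups. -/
noncomputable def addEquivProdOfIsCompl {B K : AddSubgroup M} (h : IsCompl B K) : M ≃+ B × K :=
  (Submodule.prodEquivOfIsCompl (AddSubgroup.toIntSubmodule B) (AddSubgroup.toIntSubmodule K)
    ((OrderIso.isCompl_iff AddSubgroup.toIntSubmodule).1 h)).symm.toAddEquiv

theorem Finsupp.exists_eq_nsmul_of_dvd {ι : Type v} {p : ℕ} {m : ι →₀ ℤ}
    (h : ∀ i, (p : ℤ) ∣ m i) : ∃ m' : ι →₀ ℤ, m = p • m' :=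
  ⟨m.mapRange (· / (p : ℤ)) (by simp), by
    ext i
    simp [Int.mul_ediv_cancel' (h i)]⟩

theorem exists_addEquiv_homocyclic_prod {ι : Type v} {p k : ℕ} (hp : p.Prime) (b : ι → M)
    (hb : ∀ i, p ^ (k + 1) • b i = 0)
    (hind : ∀ (m : ι →₀ ℤ) (x : M),
      p ^ k • Finsupp.linearCombination ℤ b m = p ^ (k + 1) • x → ∀ i, (p : ℤ) ∣ m i) :
    ∃ K : AddSubgroup M, Nonempty (M ≃+ (ι →₀ ZMod (p ^ (k + 1))) × K) := by
  let β := (Finsupp.linearCombination ℤ b).toAddMonoidHom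
  have hkill : ∀ m, p ^ (k + 1) • β m = 0 := fun m => by
    induction m using Finsupp.induction_linear with
    | zero => simp
    | add f g hf hg => rw [map_add, smul_add, hf, hg, add_zero]
    | single i a => simp [β, smul_comm _ a, hb]
  -- One factor `p` is peeled off at a time: after `j` factors, multiplying by `p ^ (k - j)` brings
  -- the relation back to the form required by `hind`.
  have hdvd : ∀ j ≤ k + 1, ∀ (m : ι →₀ ℤ) (x : M), β m = p ^ (k + 1) • x →
      ∃ m' : ι →₀ ℤ, m = p ^ j • m' := by
    intro j
    induction j with
    | zero => exact fun _ m _ _ => ⟨m, by simp⟩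
    | succ j ih =>
      intro hj m x hx
      obtain ⟨m', rfl⟩ := ih (by omega) m x hx
      have h1 : p ^ k • β m' = p ^ (k + 1) • (p ^ (k - j) • x) := by
        rw [smul_comm, ← hx, map_nsmul, smul_smul, ← pow_add, Nat.sub_add_cancel (by omega)]
      obtain ⟨m'', rfl⟩ := Finsupp.exists_eq_nsmul_of_dvd (hind m' _ h1)
      exact ⟨m'', by rw [smul_smul, pow_succ]⟩
  have hzero : ∀ (m : ι →₀ ℤ) (x : M), β m = p ^ (k + 1) • x → β m = 0 := fun m x hx => by
    obtain ⟨m', rfl⟩ := hdvd _ le_rfl m x hx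
    rw [map_nsmul, hkill]
  obtain ⟨K, hK⟩ := exists_isCompl_of_homocyclic (k := k) hp β.range
    (by rintro x ⟨m, hm⟩; rw [← hm]; exact hzero m x hm)
    (by
      rintro _ ⟨m, rfl⟩ h0
      obtain ⟨m', rfl⟩ := Finsupp.exists_eq_nsmul_of_dvd (hind m 0 (h0.trans (smul_zero _).symm))
      exact ⟨β m', ⟨m', rfl⟩, map_nsmul _ _ _⟩)
  let c : (ι →₀ ℤ) →+ (ι →₀ ZMod (p ^ (k + 1))) :=
    Finsupp.mapRange.addMonoidHom (Int.castAddHom (ZMod (p ^ (k + 1))))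
  have hc : Function.Surjective c :=
    Finsupp.mapRange_surjective _ (map_zero _) (ZMod.intCast_surjective)
  have hker : β.ker = c.ker := by
    ext m
    rw [AddMonoidHom.mem_ker, AddMonoidHom.mem_ker]
    constructor
    · intro h
      obtain ⟨m', rfl⟩ := hdvd _ le_rfl m 0 (by simpa using h)
      rw [map_nsmul]
      ext i
      rw [Finsupp.smul_apply, nsmul_eq_mul, ZMod.natCast_self, zero_mul, Finsupp.zero_apply]
    · intro h
      have : ∀ i, ((p ^ (k + 1) : ℕ) : ℤ) ∣ m i := fun i =>
        (ZMod.intCast_zmod_eq_zero_iff_dvd _ _).1 (DFunLike.congr_fun h i)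
      obtain ⟨m', rfl⟩ := Finsupp.exists_eq_nsmul_of_dvd this
      rw [map_nsmul, hkill]
  let e : β.range ≃+ (ι →₀ ZMod (p ^ (k + 1))) :=
    (QuotientAddGroup.quotientKerEquivRange β).symm.trans
      ((QuotientAddGroup.quotientAddEquivOfEq hker).trans
        (QuotientAddGroup.quotientKerEquivOfSurjective c hc))
  exact ⟨K, ⟨(addEquivProdOfIsCompl hK).trans (e.prodCongr (AddEquiv.refl K))⟩⟩

theorem exists_addEquiv_zmod_prod {p k : ℕ} (hp : p.Prime) {b : M} (hb : p ^ (k + 1) • b = 0)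
    (hne : ∀ x, p ^ k • b ≠ p ^ (k + 1) • x) :
    ∃ K : AddSubgroup M, Nonempty (M ≃+ ZMod (p ^ (k + 1)) × K) := by
  obtain ⟨K, ⟨e⟩⟩ := exists_addEquiv_homocyclic_prod (ι := Unit) hp (fun _ => b) (fun _ => hb) (by
    intro m x hx i
    by_contra hd
    obtain ⟨u, v, huv⟩ := (Int.isCoprime_iff_gcd_eq_one.2
      ((Nat.Prime.coprime_iff_not_dvd hp).2 fun h => hd (Int.natCast_dvd.2 h)) :
        IsCoprime (p : ℤ) (m i))
    rw [Finsupp.linearCombination_unique] at hx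
    refine hne (v • x) ?_
    calc p ^ k • b = (u * p + v * m i) • (p ^ k • b) := by rw [huv, one_smul]
      _ = u • (p ^ (k + 1) • b) + v • (p ^ k • m i • b) := by
        rw [add_smul, mul_smul, mul_smul, natCast_zsmul, smul_smul p, ← pow_succ', smul_comm (m i)]
      _ = p ^ (k + 1) • v • x := by
        rw [hb, smul_zero, zero_add, show m i • b = m default • b from rfl, hx, smul_comm])
  exact ⟨K, ⟨e.trans ((Finsupp.uniqueLinearEquiv ℤ (ZMod (p ^ (k + 1)))
    ()).toAddEquiv.prodCongr (AddEquiv.refl K))⟩⟩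

end Summand

/-! ### Prüfer groups. -/

section Pruefer

/-- The Prüfer group `ℤ(p^∞)`, as the `p`-primary component of `ℚ / ℤ`. -/
abbrev PrueferGroup (p : ℕ) : Type := AddCommGroup.primaryComponent (AddCircle (1 : ℚ)) p

theorem AddCircle.intCast_smul_eq_zero_iff {n : ℕ} (hn : n ≠ 0) (m : ℤ) :
    m • (((1 / n : ℚ)) : AddCircle (1 : ℚ)) = 0 ↔ (n : ℤ) ∣ m := by
  rw [← AddCircle.coe_zsmul, AddCircle.coe_eq_zero_iff]
  have hn' : (n : ℚ) ≠ 0 := by exact_mod_cast hn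
  constructor
  · rintro ⟨a, ha⟩
    refine ⟨a, ?_⟩
    simp only [zsmul_eq_mul, mul_one] at ha
    field_simp at ha
    rw [mul_comm]
    exact_mod_cast ha.symm
  · rintro ⟨a, rfl⟩
    refine ⟨a, ?_⟩
    simp only [zsmul_eq_mul, mul_one]
    push_cast
    field_simp

/-- The generator `1 / p ^ n` of the subgroup of `ℤ(p^∞)` of order `p ^ n`. -/
noncomputable def PrueferGroup.gen {p : ℕ} (hp : p.Prime) (n : ℕ) : PrueferGroup p :=
  ⟨((1 / (p ^ n : ℕ) : ℚ) : AddCircle (1 : ℚ)), AddCommGroup.mem_primaryComponent.2 ⟨n, by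
    rw [← natCast_zsmul, AddCircle.intCast_smul_eq_zero_iff (pow_ne_zero _ hp.ne_zero)]⟩⟩

theorem PrueferGroup.smul_gen_eq_zero_iff {p : ℕ} (hp : p.Prime) (n : ℕ) (m : ℤ) :
    m • gen hp n = 0 ↔ ((p ^ n : ℕ) : ℤ) ∣ m := by
  rw [← AddCircle.intCast_smul_eq_zero_iff (pow_ne_zero _ hp.ne_zero)]
  exact Subtype.ext_iff

theorem PrueferGroup.exists_eq_smul_gen {p : ℕ} (hp : p.Prime) (n : ℕ) {x : PrueferGroup p}
    (hx : p • x = 0) : ∃ m : ℤ, x = m • gen hp (n + 1) := by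
  obtain ⟨x, h⟩ := x
  obtain ⟨q, rfl⟩ := QuotientAddGroup.mk_surjective x
  have h1 : ((p • q : ℚ) : AddCircle (1 : ℚ)) = 0 := congrArg Subtype.val hx
  obtain ⟨j, hj⟩ := (AddCircle.coe_eq_zero_iff _).1 h1
  have hp' : (p : ℚ) ≠ 0 := by exact_mod_cast hp.ne_zero
  refine ⟨j * (p ^ n : ℕ), Subtype.ext ?_⟩
  change ((q : ℚ) : AddCircle (1 : ℚ)) = (j * (p ^ n : ℕ) : ℤ) • ((_ : ℚ) : AddCircle (1 : ℚ))
  rw [← AddCircle.coe_zsmul]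
  congr 1
  simp only [zsmul_eq_mul, mul_one, nsmul_eq_mul] at hj ⊢
  push_cast
  rw [hj]
  field_simp
  ring

theorem IsDivisibleGroup.primaryComponent {p : ℕ} {A : Type u} [AddCommGroup A]
    (hp : p.Prime) (hA : IsDivisibleGroup A) :
    IsDivisibleGroup (AddCommGroup.primaryComponent A p) := by
  intro n hn x
  obtain ⟨j, m, hm, rfl⟩ := Nat.exists_eq_pow_mul_and_not_dvd hn.ne' p hp.ne_one
  obtain ⟨y, hy⟩ := hA (p ^ j) (by have := hp.pos; positivity) x
  obtain ⟨k, hk⟩ := AddCommGroup.mem_primaryComponent.1 x.2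
  have hyk : p ^ (k + j) • y = 0 := by rw [pow_add, mul_smul, hy, hk]
  obtain ⟨u, hu⟩ := exists_coprime_smul_eq hyk ((Nat.Prime.coprime_iff_not_dvd hp).2 hm).symm
  refine ⟨⟨u • y, AddCommGroup.mem_primaryComponent.2 ⟨k + j, by
    rw [smul_comm, hyk, smul_zero]⟩⟩, Subtype.ext ?_⟩
  change (p ^ j * m) • u • y = x
  rw [mul_smul, ← natCast_zsmul (u • y), hu, hy]

theorem PrueferGroup.isDivisible {p : ℕ} (hp : p.Prime) : IsDivisibleGroup (PrueferGroup p) := by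
  refine IsDivisibleGroup.primaryComponent hp fun n hn x => ?_
  obtain ⟨q, rfl⟩ := QuotientAddGroup.mk_surjective x
  have hn' : (n : ℚ) ≠ 0 := by exact_mod_cast hn.ne'
  refine ⟨((q / n : ℚ) : AddCircle (1 : ℚ)), ?_⟩
  rw [← AddCircle.coe_nsmul]
  congr 1
  simp only [nsmul_eq_mul]
  field_simp

instance (p : ℕ) : Countable (PrueferGroup p) :=
  have : Countable (AddCircle (1 : ℚ)) := QuotientAddGroup.mk_surjective.countable
  inferInstance

theorem IsDivisibleGroup.finsupp {ι : Type v} {A : Type u} [AddCommGroup A]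
    (hA : IsDivisibleGroup A) : IsDivisibleGroup (ι →₀ A) := by
  intro n hn x
  induction x using Finsupp.induction_linear with
  | zero => exact ⟨0, by simp⟩
  | add f g hf hg =>
    obtain ⟨a, rfl⟩ := hf
    obtain ⟨b, rfl⟩ := hg
    exact ⟨a + b, smul_add _ _ _⟩
  | single i a =>
    obtain ⟨b, rfl⟩ := hA n hn a
    exact ⟨Finsupp.single i b, by simp⟩

end Pruefer

/-! ### Cyclic summands have bounded order. -/

section Unbounded

variable {G : Type u} [AddCommGroup G]

/-- `G` has cyclic summands of arbitrarily large order `p ^ (k + 1)`, expressed by generators whose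
multiple by `p ^ k` has height exactly `k`. -/
def HasUnboundedCyclicSummands (p : ℕ) (G : Type u) [AddCommGroup G] : Prop :=
  ∀ N, ∃ k, N ≤ k ∧ ∃ b : G, p ^ (k + 1) • b = 0 ∧ ∀ x, p ^ k • b ≠ p ^ (k + 1) • x

theorem pow_nsmul_eq_zero_of_le {p m n : ℕ} {x : G} (h : p ^ m • x = 0) (hmn : m ≤ n) :
    p ^ n • x = 0 := by
  rw [← Nat.sub_add_cancel hmn, pow_add, mul_smul, h, smul_zero]

/-- Once `k ≥ n`, the factor `A` is killed by `p ^ k`, so the height of `p ^ k • b` is decided in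
`K`. -/
theorem HasUnboundedCyclicSummands.of_prod {p n : ℕ} {A : Type v} {K : Type w} [AddCommGroup A]
    [AddCommGroup K] (hG : HasUnboundedCyclicSummands p G) (hA : ∀ a : A, p ^ n • a = 0)
    (e : G ≃+ A × K) : HasUnboundedCyclicSummands p K := by
  intro N
  obtain ⟨k, hk, b, hb, hne⟩ := hG (max N n)
  refine ⟨k, (le_max_left _ _).trans hk, (e b).2, ?_, fun x hx => ?_⟩
  · rw [← Prod.smul_snd, ← map_nsmul, hb, map_zero, Prod.snd_zero]
  · refine hne (e.symm (0, x)) (e.injective ?_)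
    rw [map_nsmul, map_nsmul, e.apply_symm_apply]
    refine Prod.ext ?_ hx
    rw [Prod.smul_fst, pow_nsmul_eq_zero_of_le (hA _) ((le_max_right _ _).trans hk)]
    simp

section Independence

variable {p : ℕ} {k : ℕ → ℕ} {b : ℕ → G}

/-- Look at the largest index `i₀` violating the claim and scale the relation to `p ^ k i₀`. Earlier
terms die and later ones have coefficients divisible by `p`, leaving a multiple prime to `p` of `p ^
k i₀ • b i₀` with too great a height. -/
theorem dvd_of_pow_nsmul_linearCombination (hp : p.Prime) (hk : StrictMono k)
    (hb : ∀ i, p ^ (k i + 1) • b i = 0) (hne : ∀ i x, p ^ k i • b i ≠ p ^ (k i + 1) • x)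
    {j : ℕ} {m : ℕ →₀ ℤ} {x : G}
    (h : p ^ j • Finsupp.linearCombination ℤ b m = p ^ (j + 1) • x) (i : ℕ) (hi : j ≤ k i) :
    (p : ℤ) ∣ m i := by
  classical
  by_contra hd
  let s := m.support.filter fun i => j ≤ k i ∧ ¬ (p : ℤ) ∣ m i
  have hs : s.Nonempty := ⟨i, Finset.mem_filter.2 ⟨Finsupp.mem_support_iff.2 fun h0 =>
    hd (h0 ▸ dvd_zero _), hi, hd⟩⟩
  obtain ⟨i₀, hi₀, hmax⟩ := Finset.exists_max_image s id hs
  obtain ⟨hsupp, hj₀, hd₀⟩ := Finset.mem_filter.1 hi₀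
  let R := (nsmulAddMonoidHom (α := G) (p ^ (k i₀ + 1))).range
  have h1 : p ^ k i₀ • Finsupp.linearCombination ℤ b m ∈ R := ⟨x, by
    change p ^ (k i₀ + 1) • x = _
    obtain ⟨l, hl⟩ := Nat.exists_eq_add_of_le' hj₀
    rw [hl, pow_add p l j, mul_smul, h, smul_smul, ← pow_add, add_assoc]⟩
  rw [Finsupp.linearCombination_apply, Finsupp.sum, Finset.smul_sum,
    ← Finset.add_sum_erase _ _ hsupp] at h1
  have h2 : ∑ i ∈ m.support.erase i₀, p ^ k i₀ • m i • b i ∈ R := by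
    refine R.sum_mem fun i hi => ?_
    obtain ⟨hii, his⟩ := Finset.mem_erase.1 hi
    rcases lt_or_gt_of_ne hii with hlt | hlt
    · rw [smul_comm, pow_nsmul_eq_zero_of_le (hb i) (hk hlt), smul_zero]
      exact R.zero_mem
    · have hdi : (p : ℤ) ∣ m i := by
        by_contra hdi
        exact absurd (hmax i (Finset.mem_filter.2 ⟨his, hj₀.trans (hk hlt).le, hdi⟩)) (not_le.2 hlt)
      obtain ⟨a, ha⟩ := hdi
      refine ⟨a • b i, ?_⟩
      change p ^ (k i₀ + 1) • a • b i = _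
      rw [ha, pow_succ, mul_smul, mul_smul (p : ℤ), natCast_zsmul]
  have h3 : p ^ k i₀ • m i₀ • b i₀ ∈ R := (R.add_mem_cancel_right h2).1 h1
  obtain ⟨u, v, huv⟩ := (Int.isCoprime_iff_gcd_eq_one.2
    ((Nat.Prime.coprime_iff_not_dvd hp).2 fun h => hd₀ (Int.natCast_dvd.2 h)) :
      IsCoprime (p : ℤ) (m i₀))
  have h4 : p ^ k i₀ • b i₀ = v • (p ^ k i₀ • m i₀ • b i₀) := by
    calc p ^ k i₀ • b i₀ = (u * p + v * m i₀) • (p ^ k i₀ • b i₀) := by rw [huv, one_smul]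
      _ = u • (p ^ (k i₀ + 1) • b i₀) + v • (p ^ k i₀ • m i₀ • b i₀) := by
        rw [add_smul, mul_smul, mul_smul, natCast_zsmul, smul_smul p, ← pow_succ',
          smul_comm (m i₀)]
      _ = _ := by rw [hb, smul_zero, zero_add]
  obtain ⟨y, hy⟩ := R.zsmul_mem h3 v
  exact hne i₀ y (h4.trans hy.symm)

theorem pow_dvd_of_linearCombination_eq_zero (hp : p.Prime) (hk : StrictMono k)
    (hb : ∀ i, p ^ (k i + 1) • b i = 0) (hne : ∀ i x, p ^ k i • b i ≠ p ^ (k i + 1) • x)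
    {m : ℕ →₀ ℤ} (h : Finsupp.linearCombination ℤ b m = 0) (i : ℕ) :
    ((p ^ (k i + 1) : ℕ) : ℤ) ∣ m i := by
  classical
  have key : ∀ j i, ((p ^ min j (k i + 1) : ℕ) : ℤ) ∣ m i := by
    intro j
    induction j with
    | zero => simp
    | succ j ih =>
      obtain ⟨m', hm'⟩ := Finsupp.exists_eq_nsmul_of_dvd (p := p ^ j)
        (m := m.filter fun i => j ≤ k i) (fun i => by
          by_cases hi : j ≤ k i
          · rw [Finsupp.filter_apply_pos (fun i => j ≤ k i) _ hi]
            simpa [min_eq_left (show j ≤ k i + 1 by omega)] using ih i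
          · rw [Finsupp.filter_apply_neg (fun i => j ≤ k i) _ hi]
            exact dvd_zero _)
      have h0 : Finsupp.linearCombination ℤ b (m.filter fun i => ¬ j ≤ k i) = 0 := by
        rw [Finsupp.linearCombination_apply]
        refine Finset.sum_eq_zero fun i hi => ?_
        have hi' : ¬ j ≤ k i := fun h' => Finsupp.mem_support_iff.1 hi
          (Finsupp.filter_apply_neg (fun i => ¬ j ≤ k i) m (not_not.2 h'))
        rw [Finsupp.filter_apply_pos (fun i => ¬ j ≤ k i) _ hi']
        obtain ⟨a, ha⟩ := ih i
        rw [min_eq_right (by omega)] at ha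
        change m i • b i = 0
        rw [ha, mul_comm, mul_smul, natCast_zsmul, hb, smul_zero]
      have h1 : p ^ j • Finsupp.linearCombination ℤ b m' = p ^ (j + 1) • (0 : G) := by
        rw [← map_nsmul, ← hm', smul_zero, ← h, ← Finsupp.filter_add_filter_not m fun i => j ≤ k i,
          map_add, h0, add_zero, Finsupp.filter_add_filter_not]
      intro i
      by_cases hi : j ≤ k i
      · obtain ⟨a, ha⟩ := dvd_of_pow_nsmul_linearCombination hp hk hb hne h1 i hi
        have h2 := DFunLike.congr_fun hm' i
        rw [Finsupp.filter_apply_pos (fun i => j ≤ k i) _ hi, Finsupp.smul_apply, ha] at h2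
        refine ⟨a, ?_⟩
        rw [h2, min_eq_left (by omega), nsmul_eq_mul, pow_succ]
        push_cast
        ring
      · have := ih i
        rwa [min_eq_right (by omega)] at this ⊢
  simpa using key (k i + 1) i

end Independence

theorem exists_pow_nsmul_finsupp {ι : Type v} {p : ℕ} (hG : ∀ x : G, ∃ k : ℕ, p ^ k • x = 0)
    (x : ι →₀ G) : ∃ k : ℕ, p ^ k • x = 0 := by
  induction x using Finsupp.induction_linear with
  | zero => exact ⟨0, by simp⟩
  | add f g hf hg =>
    obtain ⟨a, ha⟩ := hf
    obtain ⟨b, hb⟩ := hg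
    exact ⟨a + b, by rw [smul_add, pow_nsmul_eq_zero_of_le ha (by omega),
      pow_nsmul_eq_zero_of_le hb (by omega), add_zero]⟩
  | single i a =>
    obtain ⟨k, hk⟩ := hG a
    exact ⟨k, by rw [Finsupp.smul_single, hk, Finsupp.single_zero]⟩

/-- Write `G = ℤ/p^(k₀+1) × K` and let `B ≤ K` be generated by independent `b i` of growing order.
With `D` a countable sum of Prüfer groups, `K` maps onto `D × K/B`, while all of `G` embeds there
with full socle. The obstruction is applied to `p` times the cyclic coordinate. -/
theorem IsSemiGeneralizedCoBassian.not_hasUnboundedCyclicSummands {p : ℕ} (hp : p.Prime)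
    (hG : IsSemiGeneralizedCoBassian G) : ¬ HasUnboundedCyclicSummands p G := by
  classical
  intro hU
  -- The bound `1` ensures that `p` is nonzero in `ZMod (p ^ (k₀ + 1))`.
  obtain ⟨k₀, hk₀, b₀, hb₀, hne₀⟩ := hU 1
  obtain ⟨K, ⟨e⟩⟩ := exists_addEquiv_zmod_prod hp hb₀ hne₀
  have hK : HasUnboundedCyclicSummands p K := hU.of_prod (n := k₀ + 1) (fun a => by
    rw [nsmul_eq_mul, ZMod.natCast_self, zero_mul]) e
  let D := ℕ →₀ PrueferGroup p
  have hD : IsDivisibleGroup D := (PrueferGroup.isDivisible hp).finsupp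
  obtain ⟨u, hu⟩ := exists_surjective_nat D
  choose f hf using fun i => exists_pow_nsmul_finsupp (p := p) (fun x : PrueferGroup p => by
    obtain ⟨k, hk⟩ := AddCommGroup.mem_primaryComponent.1 x.2
    exact ⟨k, Subtype.ext hk⟩) (u i)
  -- Orders are chosen large enough that `b i ↦ u i` is well defined, where `u` enumerates the
  -- countable group `D`.
  obtain ⟨k, hk, hkb⟩ := Filter.extraction_forall_of_frequently
    (P := fun i k => f i ≤ k ∧ ∃ b : K, p ^ (k + 1) • b = 0 ∧ ∀ x, p ^ k • b ≠ p ^ (k + 1) • x)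
    (fun i => Filter.frequently_atTop.2 fun N => by
      obtain ⟨k, hk, hb⟩ := hK (max N (f i))
      exact ⟨k, (le_max_left _ _).trans hk, (le_max_right _ _).trans hk, hb⟩)
  choose hfk b hb hne using hkb
  let β := (Finsupp.linearCombination ℤ b).toAddMonoidHom
  have hβ : ∀ m, β m = 0 ↔ ∀ i, ((p ^ (k i + 1) : ℕ) : ℤ) ∣ m i := fun m => by
    refine ⟨fun h => pow_dvd_of_linearCombination_eq_zero hp hk hb hne h, fun h => ?_⟩
    change Finsupp.linearCombination ℤ b m = 0
    rw [Finsupp.linearCombination_apply]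
    refine Finset.sum_eq_zero fun i _ => ?_
    obtain ⟨a, ha⟩ := h i
    change m i • b i = 0
    rw [ha, mul_comm, mul_smul, natCast_zsmul, hb, smul_zero]
  let σ := (Finsupp.linearCombination ℤ u).toAddMonoidHom
  obtain ⟨s₀, hs₀⟩ := hD.exists_extension β σ (fun m hm => by
    change Finsupp.linearCombination ℤ u m = 0
    rw [Finsupp.linearCombination_apply]
    refine Finset.sum_eq_zero fun i _ => ?_
    obtain ⟨a, ha⟩ := (hβ m).1 hm i
    change m i • u i = 0
    rw [ha, mul_comm, mul_smul, natCast_zsmul, pow_nsmul_eq_zero_of_le (hf i)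
      ((hfk i).trans (Nat.le_succ _)), smul_zero])
  -- Coordinate `0` of `D` is reserved for the cyclic summand; `b i` embeds in coordinate `i + 1`.
  let δ := (Finsupp.linearCombination ℤ fun i =>
    (Finsupp.single (i + 1) (PrueferGroup.gen hp (k i + 1)) : D)).toAddMonoidHom
  have hδ0 : ∀ m, δ m 0 = 0 := fun m => by
    induction m using Finsupp.induction_linear with
    | zero => simp
    | add f g hf hg => rw [map_add δ, Finsupp.add_apply, hf, hg, add_zero]
    | single i a => simp [δ]
  have hδs : ∀ m i, δ m (i + 1) = m i • PrueferGroup.gen hp (k i + 1) := fun m i => by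
    induction m using Finsupp.induction_linear with
    | zero => simp
    | add f g hf hg => rw [map_add δ, Finsupp.add_apply, hf, hg, Finsupp.add_apply, add_smul]
    | single l a =>
      rcases eq_or_ne l i with rfl | hli
      · simp [δ]
      · simp [δ, Finsupp.single_eq_of_ne, hli.symm]
  obtain ⟨d, hd⟩ := hD.exists_extension β δ (fun m hm => by
    ext1 i
    cases i with
    | zero => rw [hδ0, Finsupp.zero_apply]
    | succ i =>
      rw [hδs, Finsupp.zero_apply, PrueferGroup.smul_gen_eq_zero_iff]
      exact (hβ m).1 hm i)
  let j : ZMod (p ^ (k₀ + 1)) →+ D := ZMod.lift _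
    ⟨zmultiplesHom D (Finsupp.single 0 (PrueferGroup.gen hp (k₀ + 1))), by
      rw [zmultiplesHom_apply, Finsupp.smul_single,
        (PrueferGroup.smul_gen_eq_zero_iff hp _ _).2 dvd_rfl, Finsupp.single_zero]⟩
  have hj : ∀ l : ℤ, j l = Finsupp.single 0 (l • PrueferGroup.gen hp (k₀ + 1)) := fun l => by
    rw [ZMod.lift_coe]
    exact Finsupp.smul_single _ _ _
  let q := QuotientAddGroup.mk' β.range
  let y : ZMod (p ^ (k₀ + 1)) × K →+ D × (K ⧸ β.range) :=
    (j.coprod d).prod (q.comp (AddMonoidHom.snd _ _))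
  have hy : Function.Injective y := by
    rw [injective_iff_map_eq_zero]
    rintro ⟨a, g⟩ h
    obtain ⟨l, rfl⟩ := ZMod.intCast_surjective a
    obtain ⟨m, rfl⟩ := (QuotientAddGroup.eq_zero_iff g).1 (congrArg Prod.snd h)
    have h1 : j l + δ m = 0 := by
      rw [← hd]; exact congrArg Prod.fst h
    rw [hj] at h1
    have hl := DFunLike.congr_fun h1 0
    rw [Finsupp.add_apply, hδ0, add_zero, Finsupp.single_eq_same, Finsupp.zero_apply,
      PrueferGroup.smul_gen_eq_zero_iff] at hl
    have hm : β m = 0 := (hβ m).2 fun i => by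
      have := DFunLike.congr_fun h1 (i + 1)
      rwa [Finsupp.add_apply, hδs, Finsupp.single_eq_of_ne (by simp), zero_add,
        Finsupp.zero_apply, PrueferGroup.smul_gen_eq_zero_iff] at this
    rw [hm, (ZMod.intCast_zmod_eq_zero_iff_dvd _ _).2 hl, Prod.mk_zero_zero]
  let c : ZMod (p ^ (k₀ + 1)) × K →+ ZMod (p ^ (k₀ + 1)) :=
    (nsmulAddMonoidHom p).comp (AddMonoidHom.fst _ _)
  let S := ((nsmulAddMonoidHom (α := ZMod (p ^ (k₀ + 1))) p).ker.prod ⊤).map (j.coprod δ)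
  have hS : ∀ x : D, p • x = 0 → x ∈ S := fun x hx => by
    rw [← Finsupp.sum_single x]
    refine S.sum_mem fun i _ => ?_
    have hi : p • x i = 0 := by rw [← Finsupp.smul_apply, hx, Finsupp.zero_apply]
    cases i with
    | zero =>
      obtain ⟨l, hl⟩ := PrueferGroup.exists_eq_smul_gen hp k₀ hi
      refine ⟨((l : ZMod (p ^ (k₀ + 1))), 0), ⟨?_, trivial⟩, ?_⟩
      · rw [hl, ← natCast_zsmul, smul_smul, PrueferGroup.smul_gen_eq_zero_iff,
          ← ZMod.intCast_zmod_eq_zero_iff_dvd] at hi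
        change p • (l : ZMod (p ^ (k₀ + 1))) = 0
        rw [nsmul_eq_mul]
        exact_mod_cast hi
      · rw [AddMonoidHom.coprod_apply, map_zero, add_zero, hj, hl]
    | succ i =>
      obtain ⟨l, hl⟩ := PrueferGroup.exists_eq_smul_gen hp (k i) hi
      refine ⟨(0, Finsupp.single i l), ⟨AddSubgroup.zero_mem _, trivial⟩, ?_⟩
      rw [AddMonoidHom.coprod_apply, map_zero, zero_add, hl]
      simp [δ]
  have hsoc : ∀ z : D × (K ⧸ β.range), p • z = 0 → ∃ g, y g = z ∧ c g = 0 := by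
    rintro ⟨z₁, z₂⟩ hz
    obtain ⟨g, rfl⟩ := QuotientAddGroup.mk_surjective z₂
    have h1 : p • z₁ = 0 := congrArg Prod.fst hz
    have h2 : ((p • g : K) : K ⧸ β.range) = 0 := congrArg Prod.snd hz
    -- Purity of `B`: since `p • g ∈ B`, the representative `g` can be corrected within `B` to one
    -- of order dividing `p`. The remaining error in `D` is a socle element and is absorbed by `hS`.
    obtain ⟨m, hm⟩ := (QuotientAddGroup.eq_zero_iff _).1 h2
    obtain ⟨m', rfl⟩ := Finsupp.exists_eq_nsmul_of_dvd (p := p) (m := m) fun i =>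
      dvd_of_pow_nsmul_linearCombination hp hk hb hne (j := 0) (x := g)
        (by rw [pow_zero, one_smul, zero_add, pow_one]; exact hm) i (Nat.zero_le _)
    have h3 : p • (g - β m') = 0 := by rw [smul_sub, ← hm, map_nsmul, sub_self]
    obtain ⟨⟨a, m⟩, ⟨ha, -⟩, hx⟩ := hS (z₁ - d (g - β m')) (by
      rw [smul_sub, h1, ← map_nsmul, h3, map_zero, sub_zero])
    refine ⟨(a, g - β m' + β m), Prod.ext ?_ ?_, ha⟩
    · change j a + d (g - β m' + β m) = z₁
      rw [map_add, hd, add_comm (d _), ← add_assoc]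
      rw [AddMonoidHom.coprod_apply] at hx
      rw [hx, sub_add_cancel]
    · refine (QuotientAddGroup.eq_iff_sub_mem).2 ?_
      change g - β m' + β m - g ∈ β.range
      rw [add_sub_right_comm, sub_sub_cancel_left]
      exact AddSubgroup.add_mem _ (AddSubgroup.neg_mem _ ⟨_, rfl⟩) ⟨_, rfl⟩
  have hs : Function.Surjective (s₀.prod q) := by
    rintro ⟨x, z⟩
    obtain ⟨g, rfl⟩ := QuotientAddGroup.mk_surjective z
    obtain ⟨i, hi⟩ := hu (x - s₀ g)
    refine ⟨g + β (Finsupp.single i 1), Prod.ext ?_ ?_⟩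
    · change s₀ _ = x
      rw [map_add, hs₀]
      simp [σ, hi]
    · exact (QuotientAddGroup.eq_iff_sub_mem).2 (by simp)
  -- Divisibility of `D` makes `y (1, 0)` a `p ^ (k₀ + 1)`-th multiple, so the obstruction yields `p
  -- = 0` in the cyclic group.
  obtain ⟨x, hx⟩ := hD (p ^ (k₀ + 1)) (by have := hp.pos; positivity) (j 1)
  have hc := hG.eq_zero_of_eq_pow_nsmul e hs (c := c.comp e.toAddMonoidHom)
    (y := y.comp e.toAddMonoidHom) (hy.comp e.injective) (fun z hz => by
      obtain ⟨g, hg, hc⟩ := hsoc z hz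
      exact ⟨e.symm g, by simpa using hg, by simpa using hc⟩)
    (g := e.symm (1, 0)) (z := (x, 0)) (by
      simp only [AddMonoidHom.comp_apply, AddEquiv.toAddMonoidHom_eq_coe, AddMonoidHom.coe_coe,
        AddEquiv.apply_symm_apply]
      refine Prod.ext ?_ ?_
      · change j 1 + d 0 = _
        rw [map_zero, add_zero, ← hx, Prod.smul_fst]
      · change q 0 = _
        simp)
  have h1 : ((p : ℕ) : ZMod (p ^ (k₀ + 1))) = 0 := by simpa [c] using hc
  rw [ZMod.natCast_eq_zero_iff] at h1
  have h2 := Nat.le_of_dvd hp.pos h1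
  have h3 : p ^ 1 < p ^ (k₀ + 1) := Nat.pow_lt_pow_right hp.one_lt (by omega)
  rw [pow_one] at h3
  omega

end Unbounded

/-! ### Splitting off the `p`-component. -/

section Structure

variable {G : Type u} [AddCommGroup G]

theorem exists_pow_succ_nsmul_eq {p N : ℕ}
    (h : ∀ k, N ≤ k → ∀ b : G, p ^ (k + 1) • b = 0 → ∃ x, p ^ k • b = p ^ (k + 1) • x) {x : G}
    {k : ℕ} (hx : p ^ k • x = 0) : ∃ y, p ^ N • x = p ^ (N + 1) • y := by
  have key : ∀ (j : ℕ) (x : G), p ^ (N + j) • x = 0 → ∃ y, p ^ N • x = p ^ (N + 1) • y := by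
    intro j
    induction j with
    | zero => exact fun x hx => ⟨0, by rw [smul_zero]; exact hx⟩
    | succ j ih =>
      intro x hx
      obtain ⟨y, hy⟩ := h (N + j) (Nat.le_add_right _ _) x hx
      obtain ⟨z, hz⟩ := ih (x - p • y) (by
        rw [smul_sub, smul_smul, ← pow_succ, ← hy, sub_self])
      refine ⟨z + y, ?_⟩
      rw [smul_add, ← hz, smul_sub, smul_smul, ← pow_succ, sub_add_cancel]
  exact key k x (pow_nsmul_eq_zero_of_le hx (Nat.le_add_left _ _))

theorem IsPDivisible.isDivisibleGroup {p : ℕ} (hp : p.Prime) (hG : IsPDivisible p G)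
    (htor : ∀ x : G, ∃ k : ℕ, p ^ k • x = 0) : IsDivisibleGroup G := by
  have hpow : ∀ (j : ℕ) (x : G), ∃ y, p ^ j • y = x := fun j => by
    induction j with
    | zero => exact fun x => ⟨x, by simp⟩
    | succ j ih =>
      intro x
      obtain ⟨y, rfl⟩ := ih x
      obtain ⟨z, rfl⟩ := hG y
      exact ⟨z, by rw [pow_succ, mul_smul]⟩
  intro n hn x
  obtain ⟨j, m, hm, rfl⟩ := Nat.exists_eq_pow_mul_and_not_dvd hn.ne' p hp.ne_one
  obtain ⟨y, rfl⟩ := hpow j x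
  obtain ⟨k, hk⟩ := htor y
  obtain ⟨u, hu⟩ := exists_coprime_smul_eq hk ((Nat.Prime.coprime_iff_not_dvd hp).2 hm).symm
  exact ⟨u • y, by rw [mul_smul, ← natCast_zsmul (u • y), hu]⟩

theorem linearCombination_int_eq_zmod {ι : Type v} {p : ℕ} [Module (ZMod p) G] (v : ι → G)
    (m : ι →₀ ℤ) : Finsupp.linearCombination ℤ v m =
      Finsupp.linearCombination (ZMod p) v (m.mapRange (Int.cast : ℤ → ZMod p) Int.cast_zero) := by
  induction m using Finsupp.induction_linear with
  | zero => simp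
  | add f g hf hg => rw [map_add, hf, hg, Finsupp.mapRange_add Int.cast_add, map_add]
  | single i a =>
    rw [Finsupp.mapRange_single, Finsupp.linearCombination_single, Finsupp.linearCombination_single,
      Int.cast_smul_eq_zsmul]

theorem exists_basis_of_zmod_module (p : ℕ) [Fact p.Prime] [Module (ZMod p) G] :
    ∃ (ι : Type u) (v : ι → G), (∀ x, ∃ m, Finsupp.linearCombination ℤ v m = x) ∧
      (∀ m, Finsupp.linearCombination ℤ v m = 0 → ∀ i, (p : ℤ) ∣ m i) ∧
      (Infinite G → Infinite ι) := by
  let b := Module.Free.chooseBasis (ZMod p) G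
  refine ⟨Module.Free.ChooseBasisIndex (ZMod p) G, b, fun x => ?_, fun m hm i => ?_, fun hinf => ?_⟩
  · obtain ⟨m, hm⟩ := Finsupp.mapRange_surjective (Int.cast : ℤ → ZMod p) Int.cast_zero
      ZMod.intCast_surjective (b.repr x)
    exact ⟨m, by rw [linearCombination_int_eq_zmod (p := p), hm, b.linearCombination_repr]⟩
  · rw [linearCombination_int_eq_zmod (p := p)] at hm
    have h1 := (linearIndependent_iff.1 b.linearIndependent) _ hm
    exact (ZMod.intCast_zmod_eq_zero_iff_dvd _ _).1 (DFunLike.congr_fun h1 i)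
  · by_contra h
    have : Finite (Module.Free.ChooseBasisIndex (ZMod p) G) := not_infinite_iff_finite.1 h
    have : Module.Finite (ZMod p) G := Module.Finite.of_basis b
    have : Finite G := Module.finite_of_finite (ZMod p)
    exact not_finite G

/-- A group killed by `p` has a basis over `ℤ / p`, expressed through integral combinations. -/
theorem exists_basis_of_prime_nsmul_eq_zero {p : ℕ} (hp : p.Prime) (hG : ∀ x : G, p • x = 0) :
    ∃ (ι : Type u) (v : ι → G), (∀ x, ∃ m, Finsupp.linearCombination ℤ v m = x) ∧
      (∀ m, Finsupp.linearCombination ℤ v m = 0 → ∀ i, (p : ℤ) ∣ m i) ∧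
      (Infinite G → Infinite ι) :=
  have : Fact p.Prime := ⟨hp⟩
  let _ : Module (ZMod p) G := AddCommGroup.zmodModule hG
  exists_basis_of_zmod_module p

/-- Lift a basis of `G/(pG + T_p)`. The lifts together with `p ^ N G` generate a complement:
iterating the spanning relation reaches everything modulo `T_p`, and iterating independence makes
any element in the intersection a `p ^ N`-th multiple from `T_p`, hence zero. -/
theorem exists_isCompl_primaryComponent_of_bounded {p N : ℕ} (hp : p.Prime)
    (h : ∀ x ∈ AddCommGroup.primaryComponent G p, p ^ N • x = 0) :
    ∃ K : AddSubgroup G, IsCompl (AddCommGroup.primaryComponent G p) K := by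
  let T := AddCommGroup.primaryComponent G p
  have hT : ∀ (j : ℕ) (x : G), p ^ j • x ∈ T → x ∈ T := fun j x hx => by
    obtain ⟨k, hk⟩ := AddCommGroup.mem_primaryComponent.1 hx
    exact AddCommGroup.mem_primaryComponent.2 ⟨k + j, by rw [pow_add, mul_smul, hk]⟩
  let R := (nsmulAddMonoidHom (α := G) p).range
  obtain ⟨ι, v, hv₁, hv₂, -⟩ := exists_basis_of_prime_nsmul_eq_zero (G := G ⧸ (R ⊔ T)) hp fun x => by
    obtain ⟨g, rfl⟩ := QuotientAddGroup.mk_surjective x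
    exact (QuotientAddGroup.eq_zero_iff (p • g)).2 (AddSubgroup.mem_sup_left ⟨g, rfl⟩)
  choose g hg using fun i => QuotientAddGroup.mk_surjective (v i)
  let β := (Finsupp.linearCombination ℤ g).toAddMonoidHom
  let q := QuotientAddGroup.mk' (R ⊔ T)
  have hβ : ∀ m, q (β m) = Finsupp.linearCombination ℤ v m := fun m => by
    change q.toIntLinearMap (Finsupp.linearCombination ℤ g m) = _
    rw [Finsupp.apply_linearCombination]
    congr 2
    exact funext hg
  have hspan : ∀ x, ∃ m y, x - β m - p • y ∈ T := fun x => by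
    obtain ⟨m, hm⟩ := hv₁ (q x)
    have h0 : x - β m ∈ R ⊔ T := by
      rw [← QuotientAddGroup.eq_zero_iff]
      change q (x - β m) = 0
      rw [map_sub, hβ, hm, sub_self]
    obtain ⟨_, ⟨y, rfl⟩, t, ht, hyt⟩ := AddSubgroup.mem_sup.1 h0
    exact ⟨m, y, by rw [← hyt]; simpa using ht⟩
  have hind : ∀ m y, β m - p • y ∈ T → ∃ m', m = p • m' := fun m y hm => by
    have h0 : q (β m) = 0 := (QuotientAddGroup.eq_zero_iff _).2
      (AddSubgroup.mem_sup.2 ⟨p • y, ⟨y, rfl⟩, _, hm, by abel⟩)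
    rw [hβ] at h0
    exact Finsupp.exists_eq_nsmul_of_dvd (hv₂ m h0)
  let RN := (nsmulAddMonoidHom (α := G) (p ^ N)).range
  refine ⟨β.range ⊔ RN, AddSubgroup.disjoint_def.2 fun {x} hx hxK => ?_,
    codisjoint_iff.2 (eq_top_iff.2 fun x _ => ?_)⟩
  · obtain ⟨_, ⟨m, rfl⟩, _, ⟨y, rfl⟩, hmy⟩ := AddSubgroup.mem_sup.1 hxK
    change β m + p ^ N • y = x at hmy
    have key : ∀ j ≤ N, ∃ m', m = p ^ j • m' := fun j => by
      induction j with
      | zero => exact fun _ => ⟨m, by simp⟩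
      | succ j ih =>
        intro hj
        obtain ⟨m', hm'⟩ := ih (by omega)
        obtain ⟨l, rfl⟩ := Nat.exists_eq_add_of_le' hj
        have h1 : β m' - p • (-(p ^ l • y)) ∈ T := hT j _ (by
          rw [smul_neg, sub_neg_eq_add, smul_add, ← map_nsmul, ← hm', smul_smul, smul_smul,
            show p ^ j * p * p ^ l = p ^ (l + (j + 1)) by ring, hmy]
          exact hx)
        obtain ⟨m'', rfl⟩ := hind _ _ h1
        exact ⟨m'', by rw [hm', smul_smul, pow_succ]⟩
    obtain ⟨m', rfl⟩ := key N le_rfl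
    rw [map_nsmul, ← smul_add] at hmy
    rw [← hmy]
    exact h _ (hT N _ (hmy ▸ hx))
  · have key : ∀ (j : ℕ) (x : G), ∃ m y, x - β m - p ^ j • y ∈ T := fun j => by
      induction j with
      | zero => exact fun x => ⟨0, x, by simp⟩
      | succ j ih =>
        intro x
        obtain ⟨m, y, h1⟩ := ih x
        obtain ⟨m', y', h2⟩ := hspan y
        refine ⟨m + p ^ j • m', y', ?_⟩
        have := T.add_mem h1 (T.nsmul_mem h2 (p ^ j))
        convert this using 1
        rw [map_add, map_nsmul, pow_succ, mul_smul, smul_sub, smul_sub]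
        abel
    obtain ⟨m, y, h1⟩ := key N x
    exact AddSubgroup.mem_sup.2 ⟨_, h1, β m + p ^ N • y,
      AddSubgroup.mem_sup.2 ⟨_, ⟨m, rfl⟩, _, ⟨y, rfl⟩, rfl⟩, by abel⟩

/-- The subgroup `p ^ N T_p` is divisible, so it is a retract of `G`; in the kernel of the
retraction the `p`-component is bounded. -/
theorem exists_isCompl_primaryComponent {p N : ℕ} (hp : p.Prime)
    (h : ∀ x ∈ AddCommGroup.primaryComponent G p, ∃ y, p ^ N • x = p ^ (N + 1) • y) :
    ∃ K : AddSubgroup G, IsCompl (AddCommGroup.primaryComponent G p) K := by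
  let T := AddCommGroup.primaryComponent G p
  let D := T.map (nsmulAddMonoidHom (p ^ N))
  have hDT : D ≤ T := by
    rintro _ ⟨x, hx, rfl⟩
    exact T.nsmul_mem hx _
  have hD : IsDivisibleGroup D := by
    refine IsPDivisible.isDivisibleGroup hp ?_ fun x => ?_
    · rintro ⟨_, x, hx, rfl⟩
      obtain ⟨y, hy⟩ := h x hx
      have hyT : y ∈ T := by
        obtain ⟨k, hk⟩ := AddCommGroup.mem_primaryComponent.1 hx
        exact AddCommGroup.mem_primaryComponent.2 ⟨k + (N + 1), by
          rw [pow_add, mul_smul, ← hy, smul_comm, hk, smul_zero]⟩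
      refine ⟨⟨p ^ N • y, y, hyT, rfl⟩, Subtype.ext ?_⟩
      change p • p ^ N • y = p ^ N • x
      rw [hy, smul_smul, pow_succ']
    · obtain ⟨k, hk⟩ := AddCommGroup.mem_primaryComponent.1 (hDT x.2)
      exact ⟨k, Subtype.ext hk⟩
  obtain ⟨r, hr⟩ := hD.exists_extension D.subtype (AddMonoidHom.id D) (fun x hx => Subtype.ext hx)
  obtain ⟨K, hK⟩ := exists_isCompl_primaryComponent_of_bounded (G := r.ker) (N := N) hp (by
    intro x hx
    obtain ⟨k, hk⟩ := AddCommGroup.mem_primaryComponent.1 hx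
    have hxT : (x : G) ∈ T := AddCommGroup.mem_primaryComponent.2 ⟨k, congrArg Subtype.val hk⟩
    have h0 : r (p ^ N • (x : G)) = 0 := by rw [map_nsmul, AddMonoidHom.mem_ker.1 x.2, smul_zero]
    have h1 := hr ⟨p ^ N • (x : G), x, hxT, rfl⟩
    exact Subtype.ext (show p ^ N • (x : G) = 0 from congrArg Subtype.val (h1.symm.trans h0)))
  refine ⟨K.map r.ker.subtype, AddSubgroup.disjoint_def.2 ?_,
    codisjoint_iff.2 (eq_top_iff.2 fun x _ => ?_)⟩
  · rintro _ hx ⟨y, hy, rfl⟩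
    obtain ⟨k, hk⟩ := AddCommGroup.mem_primaryComponent.1 hx
    rw [AddSubgroup.disjoint_def.1 hK.disjoint (AddCommGroup.mem_primaryComponent.2
      ⟨k, Subtype.ext hk⟩) hy, map_zero]
  · have hxk : x - r x ∈ r.ker := by
      rw [AddMonoidHom.mem_ker, map_sub, show r (r x) = r x from hr (r x), sub_self]
    have : (⟨x - r x, hxk⟩ : r.ker) ∈ AddCommGroup.primaryComponent r.ker p ⊔ K := by
      rw [hK.sup_eq_top]; trivial
    obtain ⟨t, ht, y, hy, hty⟩ := AddSubgroup.mem_sup.1 this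
    obtain ⟨k, hk⟩ := AddCommGroup.mem_primaryComponent.1 ht
    have hty' : (t : G) + y = x - r x := congrArg Subtype.val hty
    refine AddSubgroup.mem_sup.2 ⟨r x + t, T.add_mem (hDT (r x).2)
      (AddCommGroup.mem_primaryComponent.2 ⟨k, congrArg Subtype.val hk⟩), y, ⟨y, hy, rfl⟩, ?_⟩
    rw [add_assoc, hty']
    abel

/-- Apply the property of `G` to `ψ × id`. As `K` has no `p`-torsion, the projection preserves `T/H
× 0` and restricts to it. -/
theorem IsSemiGeneralizedCoBassian.of_addEquiv_prod {p : ℕ} {T : Type u} {K : Type u}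
    [AddCommGroup T] [AddCommGroup K] (hG : IsSemiGeneralizedCoBassian G) (e : G ≃+ T × K)
    (hT : ∀ x : T, ∃ k : ℕ, p ^ k • x = 0) (hK : ∀ (x : K) (k : ℕ), p ^ k • x = 0 → x = 0) :
    IsSemiGeneralizedCoBassian T := by
  rw [isSemiGeneralizedCoBassian_iff]
  intro H ψ hψ
  obtain ⟨π, hi, hφ, hess⟩ := hG.hasEssentialProjection
    (((QuotientAddGroup.mk' H).prodMap (AddMonoidHom.id K)).comp e.toAddMonoidHom)
    ((ψ.prodMap (AddMonoidHom.id K)).comp e.toAddMonoidHom)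
    (by
      have : Function.Surjective ((QuotientAddGroup.mk' H).prodMap (AddMonoidHom.id K)) := by
        rw [AddMonoidHom.coe_prodMap]
        exact (QuotientAddGroup.mk'_surjective H).prodMap Function.surjective_id
      exact this.comp e.surjective)
    (by
      have : Function.Injective (ψ.prodMap (AddMonoidHom.id K)) := by
        rw [AddMonoidHom.coe_prodMap]
        exact hψ.prodMap Function.injective_id
      exact this.comp e.injective)
  have hsnd : ∀ t : T ⧸ H, (π (t, 0)).2 = 0 := fun t => by
    obtain ⟨t, rfl⟩ := QuotientAddGroup.mk_surjective t
    obtain ⟨k, hk⟩ := hT t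
    refine hK _ k ?_
    have h0 : p ^ k • (((t : T ⧸ H), 0) : (T ⧸ H) × K) = 0 :=
      Prod.ext (congrArg (QuotientAddGroup.mk' H) hk)
        (by rw [Prod.smul_snd, smul_zero, Prod.snd_zero])
    rw [← Prod.smul_snd, ← map_nsmul, h0, map_zero, Prod.snd_zero]
  have hπ : ∀ t : T ⧸ H, π (t, 0) = ((π (t, 0)).1, 0) := fun t => Prod.ext rfl (hsnd t)
  refine ⟨(AddMonoidHom.fst _ _).comp (π.comp (AddMonoidHom.inl _ _)), fun t => ?_, fun t => ?_,
    fun t ht h0 => ?_⟩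
  · change (π ((π (t, 0)).1, 0)).1 = (π (t, 0)).1
    rw [← hπ, hi]
  · have := hφ (e.symm (t, 0))
    simp only [AddMonoidHom.comp_apply, AddEquiv.toAddMonoidHom_eq_coe, AddMonoidHom.coe_coe,
      AddEquiv.apply_symm_apply] at this
    exact congrArg Prod.fst this
  · have hker : π (t, 0) = 0 := by
      rw [hπ, show (π (t, 0)).1 = 0 from ht, Prod.mk_zero_zero]
    obtain ⟨n, hn, g, hg⟩ := hess _ hker fun h => h0 (congrArg Prod.fst h)
    exact ⟨n, fun h => hn (Prod.ext h
      (by rw [Prod.smul_snd, smul_zero, Prod.snd_zero])), (e g).1, congrArg Prod.fst hg⟩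

end Structure

/-! ### Finding a cyclic summand that can be spared. -/

section Slack

variable {T : Type u} [AddCommGroup T]

/-- A group `T` splits off a cyclic group of order `p ^ (k + 1)` whose complement surjects onto a
group which contains `T` with full `p`-socle. -/
def HasSlackSummand (p : ℕ) (T : Type u) [AddCommGroup T] : Prop :=
  ∃ (k : ℕ) (T' S : Type u) (_ : AddCommGroup T') (_ : AddCommGroup S) (s : T' →+ S) (i : T →+ S),
    Nonempty (T ≃+ ZMod (p ^ (k + 1)) × T') ∧ Function.Surjective s ∧ Function.Injective i ∧
      ∀ z, p • z = 0 → ∃ t, i t = z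

/-- The elements of the `p`-socle of height at least `j`. -/
def heightSocle (p j : ℕ) (T : Type u) [AddCommGroup T] : AddSubgroup T :=
  (nsmulAddMonoidHom p).ker ⊓ (nsmulAddMonoidHom (p ^ j)).range

theorem mem_heightSocle {p j : ℕ} {x : T} :
    x ∈ heightSocle p j T ↔ p • x = 0 ∧ ∃ y, p ^ j • y = x := Iff.rfl

/-- A countably infinite power absorbs one more factor. -/
noncomputable def finsuppNatEquiv (Z : Type v) [AddCommGroup Z] : (ℕ →₀ Z) ≃+ Z × (ℕ →₀ Z) :=
  (Finsupp.domCongr Equiv.natSumPUnitEquivNat.{0}.symm).trans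
    (Finsupp.sumFinsuppAddEquivProdFinsupp.trans (AddEquiv.prodComm.trans
      ((Finsupp.uniqueLinearEquiv ℤ Z PUnit.unit).toAddEquiv.prodCongr (AddEquiv.refl _))))

/-- An infinite Ulm–Kaplansky invariant yields a summand `(ℤ/p^(k+1))^(ℕ)`, which absorbs the loss
of one copy; the complement is again isomorphic to `T`. -/
theorem hasSlackSummand_of_infinite_quotient {p k : ℕ} (hp : p.Prime)
    (h₁ : Infinite (heightSocle p k T)) (h₂ : Finite (heightSocle p (k + 1) T)) :
    HasSlackSummand p T := by
  let A := heightSocle p k T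
  let B := (heightSocle p (k + 1) T).addSubgroupOf A
  have hB : Finite B := Finite.of_injective
    (fun x : B => (⟨x.1.1, x.2⟩ : heightSocle p (k + 1) T)) fun x y h =>
      Subtype.ext (Subtype.ext (congrArg (fun z => z.1) h))
  have hQ : Infinite (A ⧸ B) := by
    by_contra hfin
    rw [not_infinite_iff_finite] at hfin
    have : Finite A := Finite.of_equiv _ (AddSubgroup.addGroupEquivQuotientProdAddSubgroup (s := B)).symm
    exact not_finite A
  obtain ⟨ι, v, -, hv, hι⟩ := exists_basis_of_prime_nsmul_eq_zero (G := A ⧸ B) hp fun x => by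
    obtain ⟨a, rfl⟩ := QuotientAddGroup.mk_surjective x
    have : p • a = 0 := Subtype.ext (mem_heightSocle.1 a.2).1
    rw [← QuotientAddGroup.mk_nsmul, this, QuotientAddGroup.mk_zero]
  have := hι hQ
  let f := Infinite.natEmbedding ι
  choose a ha using fun n => QuotientAddGroup.mk_surjective (v (f n))
  choose hpa b hb using fun n => mem_heightSocle.1 (a n).2
  obtain ⟨K, ⟨e⟩⟩ := exists_addEquiv_homocyclic_prod (k := k) hp b
    (fun n => by rw [pow_succ', mul_smul, hb, hpa]) (by
      intro m x hx i
      have h1 : p ^ k • Finsupp.linearCombination ℤ b m =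
          A.subtype (Finsupp.linearCombination ℤ a m) := by
        change (nsmulAddMonoidHom (p ^ k)).toIntLinearMap _ = A.subtype.toIntLinearMap _
        rw [Finsupp.apply_linearCombination, Finsupp.apply_linearCombination]
        congr 2
        exact funext hb
      have h2 : Finsupp.linearCombination ℤ a m ∈ B :=
        ⟨mem_heightSocle.1 (Finsupp.linearCombination ℤ a m).2 |>.1, x, by
          rw [← h1, hx]; rfl⟩
      have h3 : Finsupp.linearCombination ℤ v (m.embDomain f) = 0 := by
        rw [Finsupp.linearCombination_embDomain, ← (QuotientAddGroup.eq_zero_iff _).2 h2]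
        change _ = (QuotientAddGroup.mk' B).toIntLinearMap _
        rw [Finsupp.apply_linearCombination]
        congr 2
        exact (funext ha).symm
      simpa using hv _ h3 (f i))
  refine ⟨k, (ℕ →₀ ZMod (p ^ (k + 1))) × K, T, inferInstance, inferInstance, e.symm.toAddMonoidHom,
    AddMonoidHom.id T, ⟨?_⟩, e.symm.surjective, Function.injective_id, fun z _ => ⟨z, rfl⟩⟩
  exact e.trans (((finsuppNatEquiv _).prodCongr (AddEquiv.refl K)).trans AddEquiv.prodAssoc)

theorem AddSubgroup.eq_top_of_socle_le {p : ℕ} (htor : ∀ x : T, ∃ k : ℕ, p ^ k • x = 0)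
    (R : AddSubgroup T) (hR : ∀ r ∈ R, ∃ r' ∈ R, p • r' = r) (hs : ∀ x, p • x = 0 → x ∈ R) :
    R = ⊤ := by
  have key : ∀ (k : ℕ) (x : T), p ^ k • x = 0 → x ∈ R := fun k => by
    induction k with
    | zero => exact fun x hx => by rw [show x = 0 by simpa using hx]; exact R.zero_mem
    | succ k ih =>
      intro x hx
      obtain ⟨r, hr, hpr⟩ := hR (p • x) (ih _ (by rw [smul_smul, ← pow_succ, hx]))
      have := R.add_mem (hs (x - r) (by rw [smul_sub, hpr, sub_self])) hr
      rwa [sub_add_cancel] at this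
  exact eq_top_iff.2 fun x _ => (htor x).elim fun k hk => key k x hk

theorem exists_surjective_prod_zmod_of_module (p : ℕ) [Fact p.Prime] [Module (ZMod p) T]
    [Infinite T] : ∃ f : T →+ T × ZMod p, Function.Surjective f := by
  have hinf : ℵ₀ ≤ Module.rank (ZMod p) T := by
    rw [← not_lt, Module.rank_lt_aleph0_iff]
    intro h
    have : Finite T := Module.finite_of_finite (ZMod p)
    exact not_finite T
  obtain ⟨e⟩ := nonempty_linearEquiv_of_lift_rank_eq (R := ZMod p) (M := T) (M' := T × ZMod p) (by
    rw [rank_prod, CommSemiring.rank_self]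
    simp [Cardinal.add_one_eq hinf])
  exact ⟨e.toAddEquiv.toAddMonoidHom, e.surjective⟩

theorem exists_surjective_prod_zmod {p : ℕ} (hp : p.Prime) (hT : ∀ x : T, p • x = 0)
    [Infinite T] : ∃ f : T →+ T × ZMod p, Function.Surjective f :=
  have : Fact p.Prime := ⟨hp⟩
  let _ : Module (ZMod p) T := AddCommGroup.zmodModule hT
  exists_surjective_prod_zmod_of_module p

theorem eq_zero_of_forall_hom_zmod_of_module (p : ℕ) [Fact p.Prime] [Module (ZMod p) T] {x : T}
    (h : ∀ φ : T →+ ZMod p, φ x = 0) : x = 0 :=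
  (Module.forall_dual_apply_eq_zero_iff (ZMod p) x).1 fun φ => h φ.toAddMonoidHom

theorem eq_zero_of_forall_hom_zmod {p : ℕ} (hp : p.Prime) (hT : ∀ x : T, p • x = 0) {x : T}
    (h : ∀ φ : T →+ ZMod p, φ x = 0) : x = 0 :=
  have : Fact p.Prime := ⟨hp⟩
  let _ : Module (ZMod p) T := AddCommGroup.zmodModule hT
  eq_zero_of_forall_hom_zmod_of_module p h

/-- The infinite socle maps onto itself plus one more `ℤ/p`. This map extends by divisibility, and
its image, being `p`-divisible and containing the whole socle, is everything. -/
theorem exists_surjective_prod_pruefer {p : ℕ} (hp : p.Prime) (hT : IsDivisibleGroup T)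
    (htor : ∀ x : T, ∃ k : ℕ, p ^ k • x = 0) (hinf : {x : T | p • x = 0}.Infinite) :
    ∃ f : T →+ T × PrueferGroup p, Function.Surjective f := by
  let V := (nsmulAddMonoidHom (α := T) p).ker
  have : Infinite V := hinf.to_subtype
  obtain ⟨f, hf⟩ := exists_surjective_prod_zmod (T := V) hp fun x => Subtype.ext x.2
  let j : ZMod p →+ PrueferGroup p := ZMod.lift p ⟨zmultiplesHom _ (PrueferGroup.gen hp 1), by
    rw [zmultiplesHom_apply, PrueferGroup.smul_gen_eq_zero_iff, pow_one]⟩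
  have hj : ∀ l : ℤ, j l = l • PrueferGroup.gen hp 1 := fun l => ZMod.lift_coe _ _ _
  have hD : IsDivisibleGroup (T × PrueferGroup p) := fun n hn x => by
    obtain ⟨a, ha⟩ := hT n hn x.1
    obtain ⟨b, hb⟩ := PrueferGroup.isDivisible hp n hn x.2
    exact ⟨(a, b), Prod.ext ha hb⟩
  obtain ⟨h, hh⟩ := hD.exists_extension V.subtype ((V.subtype.prodMap j).comp f)
    (fun x hx => by rw [show x = 0 from Subtype.ext hx, map_zero])
  refine ⟨h, AddMonoidHom.range_eq_top.1 (AddSubgroup.eq_top_of_socle_le (p := p) ?_ _ ?_ ?_)⟩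
  · rintro ⟨x, y⟩
    obtain ⟨k, hk⟩ := htor x
    obtain ⟨l, hl⟩ := AddCommGroup.mem_primaryComponent.1 y.2
    exact ⟨k + l, Prod.ext (pow_nsmul_eq_zero_of_le hk (by omega))
      (pow_nsmul_eq_zero_of_le (Subtype.ext hl : p ^ l • y = 0) (by omega))⟩
  · rintro _ ⟨x, rfl⟩
    obtain ⟨y, rfl⟩ := hT p hp.pos x
    exact ⟨h y, ⟨y, rfl⟩, (map_nsmul _ _ _).symm⟩
  · rintro ⟨x, y⟩ hxy
    obtain ⟨l, rfl⟩ := PrueferGroup.exists_eq_smul_gen hp 0 (congrArg Prod.snd hxy : p • y = 0)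
    obtain ⟨w, hw⟩ := hf (⟨x, congrArg Prod.fst hxy⟩, l)
    refine ⟨w, ?_⟩
    rw [show h w = _ from hh w, AddMonoidHom.comp_apply, hw]
    exact Prod.ext rfl (hj l)

/-- With `T = ℤ/p^(k+1) × K`, the divisible part `p ^ N K` keeps an infinite socle and so produces
an extra Prüfer factor, giving `K → K × ℤ(p^∞)` onto. The lost cyclic group embeds in that factor
with the same socle. -/
theorem hasSlackSummand_of_infinite_divisible {p N : ℕ} (hp : p.Prime)
    (htor : ∀ x : T, ∃ k : ℕ, p ^ k • x = 0)
    (hN : ∀ x : T, ∃ y, p ^ N • x = p ^ (N + 1) • y) (hT : ¬ IsDivisibleGroup T)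
    (hinf : Infinite (heightSocle p N T)) : HasSlackSummand p T := by
  obtain ⟨k, b, hb, hne⟩ : ∃ k, ∃ b : T, p ^ (k + 1) • b = 0 ∧
      ∀ x, p ^ k • b ≠ p ^ (k + 1) • x := by
    by_contra hcon
    push Not at hcon
    refine hT (IsPDivisible.isDivisibleGroup hp (fun x => ?_) htor)
    obtain ⟨k, hk⟩ := htor x
    obtain ⟨y, hy⟩ := exists_pow_succ_nsmul_eq (N := 0) (fun k _ b hb => hcon k b hb) hk
    exact ⟨y, by simpa using hy.symm⟩
  obtain ⟨K, ⟨e⟩⟩ := exists_addEquiv_zmod_prod hp hb hne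
  have htorK : ∀ x : K, ∃ k : ℕ, p ^ k • x = 0 := fun x => by
    obtain ⟨k, hk⟩ := htor x
    exact ⟨k, Subtype.ext hk⟩
  have hNK : ∀ x : K, ∃ y, p ^ N • x = p ^ (N + 1) • y := fun x => by
    obtain ⟨y, hy⟩ := hN (e.symm (0, x))
    refine ⟨(e y).2, ?_⟩
    have := congrArg (fun z => (e z).2) hy
    simpa using this
  let D := (nsmulAddMonoidHom (α := K) (p ^ N)).range
  have hD : IsDivisibleGroup D := by
    refine IsPDivisible.isDivisibleGroup hp ?_ fun x => ?_
    · rintro ⟨_, x, rfl⟩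
      obtain ⟨y, hy⟩ := hNK x
      refine ⟨⟨p ^ N • y, y, rfl⟩, Subtype.ext ?_⟩
      change p • p ^ N • y = p ^ N • x
      rw [hy, smul_smul, pow_succ']
    · obtain ⟨k, hk⟩ := htorK x
      exact ⟨k, Subtype.ext hk⟩
  have hDinf : {x : D | p • x = 0}.Infinite := by
    intro hfin
    have : NeZero (p ^ (k + 1)) := ⟨pow_ne_zero _ hp.ne_zero⟩
    refine not_finite_iff_infinite.2 hinf (Set.Finite.subset
      ((((Set.finite_univ (α := ZMod (p ^ (k + 1)))).prod (hfin.image Subtype.val)).image e.symm))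
      fun x hx => ?_)
    obtain ⟨hpx, y, hy⟩ := hx
    refine ⟨e x, ⟨trivial, ⟨⟨(e x).2, (e y).2, ?_⟩, Subtype.ext ?_, rfl⟩⟩, e.symm_apply_apply x⟩
    · change p ^ N • (e y).2 = (e x).2
      rw [← Prod.smul_snd, ← map_nsmul]
      exact congrArg (fun z => (e z).2) hy
    · change p • (e x).2 = 0
      rw [← Prod.smul_snd, ← map_nsmul, show p • x = 0 from hpx, map_zero, Prod.snd_zero]
  obtain ⟨h, hh⟩ := exists_surjective_prod_pruefer hp hD (fun x => by
    obtain ⟨k, hk⟩ := htorK x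
    exact ⟨k, Subtype.ext hk⟩) hDinf
  obtain ⟨r, hr⟩ := hD.exists_extension D.subtype (AddMonoidHom.id D) (fun x hx => Subtype.ext hx)
  have hr' : ∀ d : D, r d = d := hr
  let s : K →+ K × PrueferGroup p :=
    ((D.subtype.prodMap (AddMonoidHom.id _)).comp (h.comp r)) +
      (AddMonoidHom.inl _ _).comp (AddMonoidHom.id K - D.subtype.comp r)
  have hs : ∀ x, s x = (((h (r x)).1 : K) + (x - r x), (h (r x)).2) := fun x =>
    Prod.ext rfl (add_zero _)
  let j : ZMod (p ^ (k + 1)) →+ PrueferGroup p :=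
    ZMod.lift _ ⟨zmultiplesHom _ (PrueferGroup.gen hp (k + 1)), by
      rw [zmultiplesHom_apply, PrueferGroup.smul_gen_eq_zero_iff]⟩
  have hj : ∀ l : ℤ, j l = l • PrueferGroup.gen hp (k + 1) := fun l => ZMod.lift_coe _ _ _
  let i : ZMod (p ^ (k + 1)) × K →+ K × PrueferGroup p :=
    (AddMonoidHom.snd _ _).prod (j.comp (AddMonoidHom.fst _ _))
  have hi : Function.Injective i := by
    rw [injective_iff_map_eq_zero]
    rintro ⟨a, x⟩ hax
    obtain ⟨l, rfl⟩ := ZMod.intCast_surjective a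
    have h1 : x = 0 := congrArg Prod.fst hax
    have h2 : j l = 0 := congrArg Prod.snd hax
    rw [hj, PrueferGroup.smul_gen_eq_zero_iff] at h2
    rw [h1, (ZMod.intCast_zmod_eq_zero_iff_dvd _ _).2 h2, Prod.mk_zero_zero]
  refine ⟨k, K, K × PrueferGroup p, inferInstance, inferInstance, s, i.comp e.toAddMonoidHom, ⟨e⟩,
    ?_, hi.comp e.injective, ?_⟩
  · rintro ⟨x, y⟩
    obtain ⟨d, hd⟩ := hh (r x, y)
    refine ⟨(d : K) + (x - r x), ?_⟩
    have h1 : r ((d : K) + (x - r x)) = d := by rw [map_add, map_sub, hr', hr', sub_self, add_zero]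
    rw [hs, h1, hd]
    exact Prod.ext (by simp) rfl
  · rintro ⟨x, y⟩ hxy
    obtain ⟨l, rfl⟩ := PrueferGroup.exists_eq_smul_gen hp k (congrArg Prod.snd hxy : p • y = 0)
    refine ⟨e.symm (l, x), ?_⟩
    change i (e (e.symm (l, x))) = _
    rw [e.apply_symm_apply]
    exact Prod.ext rfl (hj l)

theorem hasSlackSummand_of_not_isDivisible {p N : ℕ} (hp : p.Prime)
    (htor : ∀ x : T, ∃ k : ℕ, p ^ k • x = 0)
    (hN : ∀ x : T, ∃ y, p ^ N • x = p ^ (N + 1) • y) (hT : ¬ IsDivisibleGroup T)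
    (hinf : {x : T | p • x = 0}.Infinite) : HasSlackSummand p T := by
  by_cases h : Infinite (heightSocle p N T)
  · exact hasSlackSummand_of_infinite_divisible hp htor hN hT h
  classical
  have hex : ∃ j, Finite (heightSocle p j T) := ⟨N, not_infinite_iff_finite.1 h⟩
  have h0 : ¬ Finite (heightSocle p 0 T) := fun hfin => hinf (Set.Finite.subset
    (Set.toFinite (heightSocle p 0 T : Set T)) fun x hx => ⟨hx, x, by simp⟩)
  -- The least height with finite socle is positive, so the socle drops from infinite to finite
  -- between heights `k` and `k + 1`.
  obtain ⟨k, hk⟩ := Nat.exists_eq_succ_of_ne_zero (n := Nat.find hex) fun hz =>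
    h0 (hz ▸ Nat.find_spec hex)
  refine hasSlackSummand_of_infinite_quotient (k := k) hp ?_ ?_
  · exact not_finite_iff_infinite.1 (Nat.find_min hex (by omega))
  · have := Nat.find_spec hex
    rwa [hk] at this

end Slack

/-! ### Necessity of the conditions. -/

section Necessity

variable {G : Type u} [AddCommGroup G]

/-- A nonzero class in `G/pG` is detected by a functional to `ℤ/p`, which embeds in `ℤ/p^(k+1)`
through multiplication by `p ^ k`. -/
theorem isPDivisible_of_forall_hom_eq_zero {p k : ℕ} (hp : p.Prime)
    (h : ∀ γ : G →+ ZMod (p ^ (k + 1)), γ = 0) : IsPDivisible p G := by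
  intro x
  let R := (nsmulAddMonoidHom (α := G) p).range
  suffices hx : (x : G ⧸ R) = 0 from (QuotientAddGroup.eq_zero_iff x).1 hx
  have hR : ∀ x : G ⧸ R, p • x = 0 := fun x => by
    obtain ⟨g, rfl⟩ := QuotientAddGroup.mk_surjective x
    exact (QuotientAddGroup.eq_zero_iff (p • g)).2 ⟨g, rfl⟩
  let j : ZMod p →+ ZMod (p ^ (k + 1)) := ZMod.lift p ⟨zmultiplesHom _ ((p ^ k : ℕ) : ZMod _), by
    rw [zmultiplesHom_apply, natCast_zsmul, nsmul_eq_mul, ← Nat.cast_mul, ← pow_succ',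
      ZMod.natCast_self]⟩
  have hj : ∀ a, j a = 0 → a = 0 := fun a ha => by
    obtain ⟨l, rfl⟩ := ZMod.intCast_surjective a
    have h1 : j l = l • ((p ^ k : ℕ) : ZMod (p ^ (k + 1))) := ZMod.lift_coe _ _ _
    rw [ha, zsmul_eq_mul] at h1
    have h2 : ((p ^ (k + 1) : ℕ) : ℤ) ∣ l * (p ^ k : ℕ) :=
      (ZMod.intCast_zmod_eq_zero_iff_dvd _ _).1 (by push_cast at h1 ⊢; exact h1.symm)
    rw [ZMod.intCast_zmod_eq_zero_iff_dvd]
    rw [pow_succ', Nat.cast_mul] at h2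
    exact Int.dvd_of_mul_dvd_mul_right (by exact_mod_cast pow_ne_zero k hp.ne_zero) h2
  refine eq_zero_of_forall_hom_zmod hp hR fun φ => hj _ ?_
  exact DFunLike.congr_fun (h ((j.comp φ).comp (QuotientAddGroup.mk' R))) x

/-- Take `Y = S × K` with `G` embedded by `i` and multiplication by `p ^ (k + 1)`, and let `c` be
any `γ` on `K`. The socle of `Y` comes from `T`, where `c` vanishes, and every `(0, x)` becomes a `p
^ (k + 1)`-th multiple; hence `γ = 0`. -/
theorem IsSemiGeneralizedCoBassian.isPDivisible_of_hasSlackSummand {p : ℕ} (hp : p.Prime)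
    {T K : Type u} [AddCommGroup T] [AddCommGroup K] (hG : IsSemiGeneralizedCoBassian G)
    (e : G ≃+ T × K) (hK : ∀ (x : K) (k : ℕ), p ^ k • x = 0 → x = 0) (hT : HasSlackSummand p T) :
    IsPDivisible p K := by
  obtain ⟨k, T', S, _, _, s, i, ⟨e'⟩, hs, hi, hsoc⟩ := hT
  refine isPDivisible_of_forall_hom_eq_zero (k := k) hp fun γ => ?_
  ext1 x
  have hsurj : Function.Surjective (s.prodMap (AddMonoidHom.id K)) := by
    rw [AddMonoidHom.coe_prodMap]
    exact hs.prodMap Function.surjective_id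
  have hinj : Function.Injective (i.prodMap (nsmulAddMonoidHom (α := K) (p ^ (k + 1)))) := by
    rw [AddMonoidHom.coe_prodMap]
    exact hi.prodMap ((injective_iff_map_eq_zero _).2 fun x hx => hK x _ hx)
  have := hG.eq_zero_of_eq_pow_nsmul (p := p) (n := k + 1)
    (e.trans ((e'.prodCongr (AddEquiv.refl K)).trans AddEquiv.prodAssoc)) hsurj
    (c := (γ.comp (AddMonoidHom.snd T K)).comp e.toAddMonoidHom)
    (y := (i.prodMap (nsmulAddMonoidHom (α := K) (p ^ (k + 1)))).comp e.toAddMonoidHom)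
    (hinj.comp e.injective) (fun z hz => by
      obtain ⟨t, ht⟩ := hsoc z.1 (congrArg Prod.fst hz)
      have h2 : z.2 = 0 := hK z.2 1 (by rw [pow_one]; exact congrArg Prod.snd hz)
      refine ⟨e.symm (t, 0), ?_, by simp⟩
      simp [Prod.ext_iff, ht, h2])
    (g := e.symm (0, x)) (z := (0, x)) (by simp)
  simpa using this

theorem IsSemiGeneralizedCoBassian.primary_condition {p : ℕ} (hp : p.Prime)
    (hG : IsSemiGeneralizedCoBassian G) :
    IsSemiGeneralizedCoBassian (AddCommGroup.primaryComponent G p) ∧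
      (pRank p (AddCommGroup.primaryComponent G p) < ℵ₀ ∨
        IsDivisibleGroup (AddCommGroup.primaryComponent G p) ∨
        IsPDivisible p (G ⧸ AddCommGroup.torsion G)) := by
  let T := AddCommGroup.primaryComponent G p
  have hU := hG.not_hasUnboundedCyclicSummands hp
  simp only [HasUnboundedCyclicSummands] at hU
  push Not at hU
  obtain ⟨N, hN⟩ := hU
  have hN' : ∀ x ∈ T, ∃ y, p ^ N • x = p ^ (N + 1) • y := fun x hx => by
    obtain ⟨k, hk⟩ := AddCommGroup.mem_primaryComponent.1 hx
    exact exists_pow_succ_nsmul_eq hN hk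
  obtain ⟨K, hK⟩ := exists_isCompl_primaryComponent hp hN'
  let e := addEquivProdOfIsCompl hK
  have htor : ∀ x : T, ∃ k : ℕ, p ^ k • x = 0 := fun x => by
    obtain ⟨k, hk⟩ := AddCommGroup.mem_primaryComponent.1 x.2
    exact ⟨k, Subtype.ext hk⟩
  have hKtor : ∀ (x : K) (k : ℕ), p ^ k • x = 0 → x = 0 := fun x k hx =>
    Subtype.ext (AddSubgroup.disjoint_def.1 hK.disjoint
      (AddCommGroup.mem_primaryComponent.2 ⟨k, congrArg Subtype.val hx⟩) x.2)
  refine ⟨hG.of_addEquiv_prod e htor hKtor, ?_⟩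
  by_contra! hcon
  obtain ⟨hr, hD, hP⟩ := hcon
  have hslack : HasSlackSummand p T := hasSlackSummand_of_not_isDivisible (N := N) hp htor
    (fun x => by
      obtain ⟨y, hy⟩ := hN' x x.2
      obtain ⟨k, hk⟩ := AddCommGroup.mem_primaryComponent.1 x.2
      exact ⟨⟨y, AddCommGroup.mem_primaryComponent.2 ⟨k + (N + 1), by
        rw [pow_add, mul_smul, ← hy, smul_comm, hk, smul_zero]⟩⟩, Subtype.ext hy⟩) hD
    (fun hfin => not_lt.2 hr ((pRank_lt_aleph0_iff hp).2 hfin))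
  have hKP := hG.isPDivisible_of_hasSlackSummand hp e hKtor hslack
  refine hP fun x => ?_
  obtain ⟨g, rfl⟩ := QuotientAddGroup.mk_surjective x
  obtain ⟨κ, hκ⟩ := hKP (e g).2
  refine ⟨(e.symm (0, κ) : G), ?_⟩
  rw [← QuotientAddGroup.mk_nsmul]
  refine QuotientAddGroup.eq_iff_sub_mem.2 ?_
  obtain ⟨k, hk⟩ := htor (e g).1
  refine isOfFinAddOrder_iff_nsmul_eq_zero.2 ⟨p ^ k, by have := hp.pos; positivity,
    e.injective (Prod.ext ?_ ?_)⟩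
  · simp [smul_sub, hk]
  · simp [hκ]

end Necessity

theorem theorem2 (G : Type*) [AddCommGroup G] (hG : torsionFreeRank G < ℵ₀) :
    IsSemiGeneralizedCoBassian G ↔
      ∀ p : ℕ, p.Prime →
        IsSemiGeneralizedCoBassian (AddCommGroup.primaryComponent G p) ∧
          (pRank p (AddCommGroup.primaryComponent G p) < ℵ₀ ∨
            IsDivisibleGroup (AddCommGroup.primaryComponent G p) ∨
            IsPDivisible p (G ⧸ AddCommGroup.torsion G)) :=
  ⟨fun h _ hp => h.primary_condition hp, isSemiGeneralizedCoBassian_of_primary hG⟩
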